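/- Let $M$ be a smooth manifold with a hypercomplex structure, i.e. integrable complex structures $I_1,I_2,I_3$ with $I_1I_2=I_3=-I_2I_1$, and let $g$ be a Riemannian metric that is Hermitian with respect to each $I_a$. Let $F_a(X,Y)=g(I_aX,Y)$ be the Kähler forms. For an $n$-form $\omega$ put $(I_a\omega)(X_1,\dots,X_n)=(-1)^n\omega(I_aX_1,\dots,I_aX_n)$, $d_a\omega=(-1)^nI_a\,d\,I_a\omega$, $\partial_a=\tfrac12(d+i\,d_a)$ and $\overline\partial_a=\tfrac12(d-i\,d_a)$. A (smooth) linear connection $\nabla$ is an HKT-connection if $\nabla g=0$, $\nabla I_1=\nabla I_2=\nabla I_3=0$ and its torsion $c(X,Y,Z)=g(X,T(Y,Z))$ is totally skew-symmetric; $(M,I_1,I_2,I_3,g)$ is HKT if it admits an HKT-connection. The Bismut connection of $(I_a,g)$ is the unique connection with $\nabla g=0$, $\nabla I_a=0$ and totally skew-symmetric torsion. With respect to $I_1$, the form $F_2+iF_3$ is of type $(2,0)$ and $F_2-iF_3$ is of type $(0,2)$, and the following conditions are equivalent: 1. $(M,I_1,I_2,I_3,g)$ is HKT; 2. $\partial_1(F_2+iF_3)=0$;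 3. $\overline\partial_1(F_2-iF_3)=0$; 4. $d_2F_2=d_3F_3$; 5. the Bismut connections of $(I_2,g)$ and $(I_3,g)$ coincide, i.e. one connection is the Bismut connection of both. -/

import Mathlib

open Bundle
open scoped Manifold ContDiff

noncomputable section

namespace HKT

section Forms

variable {E : Type*} [NormedAddCommGroup E] [NormedSpace ℝ E]
  {M : Type*} [TopologicalSpace M] [ChartedSpace E M]
  {V : Type*} [NormedAddCommGroup V] [NormedSpace ℝ V]

/-- A field of endomorphisms of the tangent bundle. -/
abbrev EndField (E : Type*) [NormedAddCommGroup E] [NormedSpace ℝ E]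
    (M : Type*) [TopologicalSpace M] [ChartedSpace E M] :=
  Π x : M, TangentSpace 𝓘(ℝ, E) x →L[ℝ] TangentSpace 𝓘(ℝ, E) x

/-- A (not necessarily smooth) differential `n`-form on `M` with values in `V`. -/
abbrev DiffForm (E : Type*) [NormedAddCommGroup E] [NormedSpace ℝ E]
    (M : Type*) [TopologicalSpace M] [ChartedSpace E M]
    (V : Type*) [NormedAddCommGroup V] [NormedSpace ℝ V] (n : ℕ) :=
  Π x : M, TangentSpace 𝓘(ℝ, E) x [⋀^Fin n]→L[ℝ] V

/-- The expression of a differential form in the preferred chart at `x`: its pullback under the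
inverse of the chart. -/
def chartForm {n : ℕ} (α : DiffForm E M V n) (x : M) (y : E) : E [⋀^Fin n]→L[ℝ] V :=
  (α ((extChartAt 𝓘(ℝ, E) x).symm y)).compContinuousLinearMap
    (mfderiv 𝓘(ℝ, E) 𝓘(ℝ, E) (extChartAt 𝓘(ℝ, E) x).symm y :
      E →L[ℝ] TangentSpace 𝓘(ℝ, E) ((extChartAt 𝓘(ℝ, E) x).symm y))

/-- The exterior derivative of a differential form on a manifold (without boundary), computed at
each point in the preferred chart there. -/
def d {n : ℕ} (α : DiffForm E M V n) : DiffForm E M V (n + 1) := fun x ↦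
  (extDeriv (chartForm α x) (extChartAt 𝓘(ℝ, E) x x)).compContinuousLinearMap
    (mfderiv 𝓘(ℝ, E) 𝓘(ℝ, E) (extChartAt 𝓘(ℝ, E) x) x : TangentSpace 𝓘(ℝ, E) x →L[ℝ] E)

/-- The action of an endomorphism field on `n`-forms,
`(Jα)(X₁, …, Xₙ) = (-1)ⁿ α(JX₁, …, JXₙ)`. -/
def act (J : EndField E M) {n : ℕ} (α : DiffForm E M V n) : DiffForm E M V n := fun x ↦
  (-1 : ℝ) ^ n • (α x).compContinuousLinearMap (J x)

/-- The twisted differential `dᶜα = (-1)ⁿ J d J α` of an `n`-form. -/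
def dc (J : EndField E M) {n : ℕ} (α : DiffForm E M V n) : DiffForm E M V (n + 1) := fun x ↦
  (-1 : ℝ) ^ n • act J (d (act J α)) x

/-- `∂ = (d + i dᶜ) / 2` on complex-valued forms. -/
def del (J : EndField E M) {n : ℕ} (α : DiffForm E M ℂ n) : DiffForm E M ℂ (n + 1) := fun x ↦
  (1 / 2 : ℂ) • (d α x + Complex.I • dc J α x)

/-- `∂̄ = (d - i dᶜ) / 2` on complex-valued forms. -/
def delbar (J : EndField E M) {n : ℕ} (α : DiffForm E M ℂ n) : DiffForm E M ℂ (n + 1) := fun x ↦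
  (1 / 2 : ℂ) • (d α x - Complex.I • dc J α x)

/-- A real form regarded as a complex-valued form. -/
def toComplex {n : ℕ} (α : DiffForm E M ℝ n) : DiffForm E M ℂ n := fun x ↦
  Complex.ofRealCLM.compContinuousAlternatingMap (α x)

/-- An `n`-form is of type `(n, 0)` if it is complex linear with respect to `J` in each slot. -/
def IsHolType (J : EndField E M) {n : ℕ} (α : DiffForm E M ℂ n) : Prop :=
  ∀ (x : M) (v : Fin n → TangentSpace 𝓘(ℝ, E) x) (i : Fin n),
    α x (Function.update v i (J x (v i))) = Complex.I * α x v

/-- An `n`-form is of type `(0, n)` if it is complex antilinear with respect to `J` in each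
slot. -/
def IsAntiholType (J : EndField E M) {n : ℕ} (α : DiffForm E M ℂ n) : Prop :=
  ∀ (x : M) (v : Fin n → TangentSpace 𝓘(ℝ, E) x) (i : Fin n),
    α x (Function.update v i (J x (v i))) = -Complex.I * α x v

end Forms

section ComplexStructures

variable (E : Type*) [NormedAddCommGroup E] [NormedSpace ℝ E]
  (M : Type*) [TopologicalSpace M] [ChartedSpace E M] [IsManifold 𝓘(ℝ, E) ∞ M]

/-- An integrable complex structure: a smooth almost complex structure whose Nijenhuis tensor
`[JX, JY] - [X, Y] - J([JX, Y] + [X, JY])` vanishes. -/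
structure ComplexStructure where
  /-- the endomorphism field -/
  J : EndField E M
  contMDiff : ContMDiff 𝓘(ℝ, E) (𝓘(ℝ, E).prod 𝓘(ℝ, E →L[ℝ] E)) ∞
    (fun x ↦ TotalSpace.mk' (E →L[ℝ] E)
      (E := fun x : M ↦ TangentSpace 𝓘(ℝ, E) x →L[ℝ] TangentSpace 𝓘(ℝ, E) x) x (J x))
  sq : ∀ (x : M) (v : TangentSpace 𝓘(ℝ, E) x), J x (J x v) = -v
  integrable : ∀ (X Y : Π x : M, TangentSpace 𝓘(ℝ, E) x) (x : M),
    MDiffAt (T% X) x → MDiffAt (T% Y) x →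
    VectorField.mlieBracket 𝓘(ℝ, E) (fun y ↦ J y (X y)) (fun y ↦ J y (Y y)) x
      - VectorField.mlieBracket 𝓘(ℝ, E) X Y x
      - J x (VectorField.mlieBracket 𝓘(ℝ, E) (fun y ↦ J y (X y)) Y x
        + VectorField.mlieBracket 𝓘(ℝ, E) X (fun y ↦ J y (Y y)) x) = 0

/-- A hypercomplex structure: three integrable complex structures with
`I₁ I₂ = I₃ = -I₂ I₁`. -/
structure HypercomplexStructure where
  /-- first complex structure -/
  I₁ : ComplexStructure E M
  /-- second complex structure -/
  I₂ : ComplexStructure E M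
  /-- third complex structure -/
  I₃ : ComplexStructure E M
  mul₁₂ : ∀ (x : M) (v : TangentSpace 𝓘(ℝ, E) x), I₁.J x (I₂.J x v) = I₃.J x v
  mul₂₁ : ∀ (x : M) (v : TangentSpace 𝓘(ℝ, E) x), I₂.J x (I₁.J x v) = -I₃.J x v

end ComplexStructures

section Hermitian

variable {E : Type*} [NormedAddCommGroup E] [NormedSpace ℝ E]
  {M : Type*} [TopologicalSpace M] [ChartedSpace E M] [IsManifold 𝓘(ℝ, E) ∞ M]

/-- Smooth Riemannian metrics on `M`. -/
abbrev Metric (E : Type*) [NormedAddCommGroup E] [NormedSpace ℝ E]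
    (M : Type*) [TopologicalSpace M] [ChartedSpace E M] [IsManifold 𝓘(ℝ, E) ∞ M] :=
  ContMDiffRiemannianMetric 𝓘(ℝ, E) ∞ E (fun x : M ↦ TangentSpace 𝓘(ℝ, E) x)

/-- The metric `g` is Hermitian with respect to the complex structure. -/
def IsHermitian (g : Metric E M) (S : ComplexStructure E M) : Prop :=
  ∀ (x : M) (u v : TangentSpace 𝓘(ℝ, E) x), g.inner x (S.J x u) (S.J x v) = g.inner x u v

/-- The metric `g` is hyper-Hermitian with respect to the hypercomplex structure. -/
structure IsHyperHermitian (g : Metric E M) (S : HypercomplexStructure E M) : Prop where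
  I₁ : IsHermitian g S.I₁
  I₂ : IsHermitian g S.I₂
  I₃ : IsHermitian g S.I₃

theorem IsHermitian.inner_self {g : Metric E M} {S : ComplexStructure E M}
    (h : IsHermitian g S) (x : M) (v : TangentSpace 𝓘(ℝ, E) x) :
    g.inner x (S.J x v) v = 0 := by
  have h1 := h x (S.J x v) v
  rw [S.sq, g.symm x (S.J x v) v] at h1
  have h2 := g.symm x (S.J x v) v
  simp only [map_neg, neg_apply] at h1
  linarith

theorem continuous_bilinear (B : E →L[ℝ] E →L[ℝ] ℝ) :
    Continuous (fun v : Fin 2 → E ↦ B (v 0) (v 1)) :=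
  (B.continuous.comp (continuous_apply 0)).clm_apply (continuous_apply 1)

/-- The Kähler form `F(X, Y) = g(JX, Y)` of a Hermitian structure. -/
def kahlerForm {g : Metric E M} {S : ComplexStructure E M} (h : IsHermitian g S) :
    DiffForm E M ℝ 2 := fun x ↦
  { toFun := fun v ↦ g.inner x (S.J x (v 0)) (v 1)
    map_update_add' := by
      intro _ m i u v
      fin_cases i
      · simp [Function.update]
      · simp [Function.update]
    map_update_smul' := by
      intro _ m i c v
      fin_cases i
      · simp [Function.update]
      · simp [Function.update]
    cont := by
      exact continuous_bilinear (E := E) ((g.inner x).comp (S.J x))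
    map_eq_zero_of_eq' := by
      intro v i j hij hne
      have h01 : v 0 = v 1 := by
        fin_cases i <;> fin_cases j <;> simp_all
      show g.inner x (S.J x (v 0)) (v 1) = 0
      rw [h01]
      exact h.inner_self x (v 1) }

/-- The form `F₂ + i F₃`. -/
def formPlus {g : Metric E M} {S : HypercomplexStructure E M} (h : IsHyperHermitian g S) :
    DiffForm E M ℂ 2 :=
  fun x ↦ toComplex (kahlerForm h.I₂) x + Complex.I • toComplex (kahlerForm h.I₃) x

/-- The form `F₂ - i F₃`. -/
def formMinus {g : Metric E M} {S : HypercomplexStructure E M} (h : IsHyperHermitian g S) :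
    DiffForm E M ℂ 2 :=
  fun x ↦ toComplex (kahlerForm h.I₂) x - Complex.I • toComplex (kahlerForm h.I₃) x

end Hermitian

section Connections

variable {E : Type*} [NormedAddCommGroup E] [NormedSpace ℝ E] [FiniteDimensional ℝ E]
  [CompleteSpace E]
  {M : Type*} [TopologicalSpace M] [ChartedSpace E M] [IsManifold 𝓘(ℝ, E) ∞ M]

/-- A linear connection on (the tangent bundle of) `M`. -/
abbrev Connection (E : Type*) [NormedAddCommGroup E] [NormedSpace ℝ E]
    (M : Type*) [TopologicalSpace M] [ChartedSpace E M] [IsManifold 𝓘(ℝ, E) ∞ M] :=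
  CovariantDerivative 𝓘(ℝ, E) E (fun x : M ↦ TangentSpace 𝓘(ℝ, E) x)

/-- `∇g = 0`, that is `v(g(X, Y)) = g(∇_v X, Y) + g(X, ∇_v Y)` for all vector fields `X`, `Y` and
tangent vectors `v`. -/
def IsMetric (g : Metric E M) (cov : Connection E M) : Prop :=
  ∀ (X Y : Π x : M, TangentSpace 𝓘(ℝ, E) x) (x : M), MDiffAt (T% X) x → MDiffAt (T% Y) x →
    ∀ v : TangentSpace 𝓘(ℝ, E) x,
      mfderiv 𝓘(ℝ, E) 𝓘(ℝ, ℝ) (fun y ↦ g.inner y (X y) (Y y)) x v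
        = g.inner x (cov X x v) (Y x) + g.inner x (X x) (cov Y x v)

/-- `∇J = 0`, that is `∇_v (JY) = J (∇_v Y)` for all vector fields `Y` and tangent vectors `v`. -/
def IsParallel (cov : Connection E M) (J : EndField E M) : Prop :=
  ∀ (Y : Π x : M, TangentSpace 𝓘(ℝ, E) x) (x : M), MDiffAt (T% Y) x →
    ∀ v : TangentSpace 𝓘(ℝ, E) x, cov (fun y ↦ J y (Y y)) x v = J x (cov Y x v)

/-- The `(3,0)`-torsion tensor `c(X, Y, Z) = g(X, T(Y, Z))`. -/
def torsionTensor (g : Metric E M) (cov : Connection E M)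
    (x : M) (u v w : TangentSpace 𝓘(ℝ, E) x) : ℝ :=
  g.inner x u (cov.torsion x v w)

/-- The torsion is totally skew-symmetric. -/
def HasSkewTorsion (g : Metric E M) (cov : Connection E M) : Prop :=
  ∀ (x : M) (u v w : TangentSpace 𝓘(ℝ, E) x),
    torsionTensor g cov x u v w = -torsionTensor g cov x v u w ∧
    torsionTensor g cov x u v w = -torsionTensor g cov x u w v

/-- A smooth linear connection which is metric and has totally skew-symmetric torsion. -/
structure IsMetricSkewConnection (g : Metric E M) (cov : Connection E M) : Prop where
  smooth : CovariantDerivative.ContMDiffCovariantDerivative cov ∞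
  metric : IsMetric g cov
  skew : HasSkewTorsion g cov

/-- The connection is the Bismut connection of the Hermitian structure: `∇g = 0`, `∇J = 0` and
the torsion is totally skew-symmetric. -/
structure IsBismutConnection (g : Metric E M) (S : ComplexStructure E M)
    (cov : Connection E M) : Prop extends IsMetricSkewConnection g cov where
  parallel : IsParallel cov S.J

/-- The connection is an HKT-connection: `∇g = 0`, `∇I₁ = ∇I₂ = ∇I₃ = 0` and the torsion is
totally skew-symmetric. -/
structure IsHKTConnection (g : Metric E M) (S : HypercomplexStructure E M)
    (cov : Connection E M) : Prop extends IsMetricSkewConnection g cov where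
  parallel₁ : IsParallel cov S.I₁.J
  parallel₂ : IsParallel cov S.I₂.J
  parallel₃ : IsParallel cov S.I₃.J

/-- The hyper-Hermitian structure is an HKT-structure: it admits an HKT-connection. -/
def IsHKT (g : Metric E M) (S : HypercomplexStructure E M) : Prop :=
  ∃ cov : Connection E M, IsHKTConnection g S cov

/-- The Bismut connections of the Hermitian structures `(S, g)` and `(S', g)` coincide. -/
def SameBismutConnection (g : Metric E M) (S S' : ComplexStructure E M) : Prop :=
  ∃ cov : Connection E M, IsBismutConnection g S cov ∧ IsBismutConnection g S' cov

end Connections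

end HKT

end

open scoped Topology

namespace HKT

/-! ### Regularity of `J Y`, of `g(X, Y)` and of derivatives along vector fields. -/

section Basic

variable {E : Type*} [NormedAddCommGroup E] [NormedSpace ℝ E]
  {M : Type*} [TopologicalSpace M] [ChartedSpace E M] [IsManifold 𝓘(ℝ, E) ∞ M]

/-! Everything rests on the torsion of the Bismut connection being determined by the Hermitian
structure: a metric connection with skew torsion `c` preserves `J` if and only if `c = -dᶜF`, that
is `c(X, Y, Z) = dF(JX, JY, JZ)` (`isParallel_iff`). To see this, put `A(X; Y, Z) = g((∇_X J)Y, Z)`.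
Cartan's formula expresses `dF` through `A` and `c` (`d_kahlerForm_eq`), and integrability gives a
second linear relation between them (`nijenhuis_eq`). If `A = 0`, the two together yield `c = -dᶜF`.
Conversely, if `c = -dᶜF`, the torsion terms cancel and the symmetries of `A` force `A = 0`.

Existence comes from the Koszul formula: for every three-form `c` there is a metric connection with
torsion `c` (`koszulConnection`), smooth when `c` is. Hence one connection is Bismut for both `I₂`
and `I₃` exactly when `d₂F₂ = d₃F₃` (`sameBismutConnection_iff`). Such a connection also preserves
`I₁ = -I₃I₂`, so it is an HKT-connection (`isHKT_iff`).

The remaining conditions are algebra. Since `I₁` acts by `-1` on `F₂` and `F₃`, one has `d₁(F₂ ±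
iF₃) = d(F₂ ± iF₃)(I₁·, I₁·, I₁·)`. Real and imaginary parts of `∂₁(F₂ + iF₃) = 0` and of its
conjugate then both say `dF₂ = dF₃(I₁·, I₁·, I₁·)`. Substituting `I₂·` into `d₂F₂ = d₃F₃` and using
`I₃I₂ = -I₁` gives the same equation. -/

theorem ComplexStructure.mdifferentiableAt_apply (S : ComplexStructure E M)
    {Y : Π x : M, TangentSpace 𝓘(ℝ, E) x} {x : M} (hY : MDiffAt (T% Y) x) :
    MDiffAt (T% (fun y ↦ S.J y (Y y))) x :=
  ((S.contMDiff.contMDiffAt (x := x)).mdifferentiableAt (by simp)).clm_bundle_apply hY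

theorem ComplexStructure.contMDiffAt_apply (S : ComplexStructure E M)
    {Y : Π x : M, TangentSpace 𝓘(ℝ, E) x} {x : M} (hY : CMDiffAt ∞ (T% Y) x) :
    CMDiffAt ∞ (T% (fun y ↦ S.J y (Y y))) x :=
  (S.contMDiff.contMDiffAt (x := x)).clm_bundle_apply hY

theorem mdifferentiableAt_inner (g : Metric E M)
    {X Y : Π x : M, TangentSpace 𝓘(ℝ, E) x} {x : M} (hX : MDiffAt (T% X) x)
    (hY : MDiffAt (T% Y) x) : MDiffAt (fun y ↦ g.inner y (X y) (Y y)) x := by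
  have := MDifferentiableAt.clm_bundle_apply₂ (F₁ := E) (F₂ := E) (F₃ := ℝ)
    (E₃ := Bundle.Trivial M ℝ)
    ((g.contMDiff.contMDiffAt (x := x)).mdifferentiableAt (by simp)) hX hY
  simp only [mdifferentiableAt_totalSpace] at this
  exact this.2

theorem contMDiffAt_inner (g : Metric E M) {n : WithTop ℕ∞} (hn : n ≤ ∞)
    {X Y : Π x : M, TangentSpace 𝓘(ℝ, E) x} {x : M} (hX : CMDiffAt n (T% X) x)
    (hY : CMDiffAt n (T% Y) x) : CMDiffAt n (fun y ↦ g.inner y (X y) (Y y)) x := by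
  have := ContMDiffAt.clm_bundle_apply₂ (F₁ := E) (F₂ := E) (F₃ := ℝ)
    (E₃ := Bundle.Trivial M ℝ)
    ((g.contMDiff.contMDiffAt (x := x)).of_le hn) hX hY
  simp only [contMDiffAt_totalSpace] at this
  exact this.2

theorem kahlerForm_apply {g : Metric E M} {S : ComplexStructure E M} (h : IsHermitian g S)
    (x : M) (v : Fin 2 → TangentSpace 𝓘(ℝ, E) x) :
    kahlerForm h x v = g.inner x (S.J x (v 0)) (v 1) := rfl

theorem IsHermitian.inner_apply_left {g : Metric E M} {S : ComplexStructure E M}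
    (h : IsHermitian g S) (x : M) (u v : TangentSpace 𝓘(ℝ, E) x) :
    g.inner x (S.J x u) v = -g.inner x u (S.J x v) := by
  have h1 := h x u (S.J x v)
  rw [S.sq] at h1
  rw [← h1, map_neg, neg_neg]

theorem contMDiffAt_mvfderiv_apply {f : M → ℝ} {X : Π x : M, TangentSpace 𝓘(ℝ, E) x} {x : M}
    (hf : CMDiffAt ∞ f x) (hX : CMDiffAt ∞ (T% X) x) :
    CMDiffAt ∞ (fun y ↦ mvfderiv 𝓘(ℝ, E) f y (X y)) x := by
  have : IsManifold 𝓘(ℝ, E) 1 M := IsManifold.of_le (n := ∞) (by simp)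
  have h1 := hf.mfderiv_const (m := ∞) (by simp)
  have h2 := ContMDiffAt.clm_apply_of_inCoordinates (F₁ := E) (F₂ := ℝ)
    (E₁ := fun x : M ↦ TangentSpace 𝓘(ℝ, E) x) (E₂ := fun x : ℝ ↦ TangentSpace 𝓘(ℝ, ℝ) x)
    (b₁ := id) (b₂ := f) (ϕ := fun y ↦ mfderiv 𝓘(ℝ, E) 𝓘(ℝ, ℝ) f y) (v := X) h1 hX hf
  exact ((contMDiff_snd_tangentBundle_modelSpace ℝ 𝓘(ℝ, ℝ)).contMDiffAt).comp x h2

end Basic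

/-! ### Vector fields, brackets and derivatives read in a chart. -/

section ChartFields

variable {E : Type*} [NormedAddCommGroup E] [NormedSpace ℝ E]
  {M : Type*} [TopologicalSpace M] [ChartedSpace E M]
  {V : Type*} [NormedAddCommGroup V] [NormedSpace ℝ V]

/-- The derivative at `x` of the preferred chart at `x`. -/
noncomputable def chartDeriv (x : M) : E →L[ℝ] E :=
  mfderiv 𝓘(ℝ, E) 𝓘(ℝ, E) (extChartAt 𝓘(ℝ, E) x) x

/-- The derivative at `y` of the inverse of the preferred chart at `x`. -/
noncomputable def chartSymmDeriv (x : M) (y : E) : E →L[ℝ] E :=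
  mfderiv 𝓘(ℝ, E) 𝓘(ℝ, E) (extChartAt 𝓘(ℝ, E) x).symm y

/-- The expression of a vector field in the preferred chart at `x`. -/
noncomputable def chartField (X : Π x : M, TangentSpace 𝓘(ℝ, E) x) (x : M) (y : E) : E :=
  VectorField.mpullbackWithin 𝓘(ℝ, E) 𝓘(ℝ, E) (extChartAt 𝓘(ℝ, E) x).symm X
    (Set.range 𝓘(ℝ, E)) y

theorem chartForm_apply {n : ℕ} (α : DiffForm E M V n) {x p : M} {y : E}
    (hp : (extChartAt 𝓘(ℝ, E) x).symm y = p) (v : Fin n → E) :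
    chartForm α x y v = α p (fun i ↦ chartSymmDeriv x y (v i)) := by
  subst hp; rfl

theorem d_apply {n : ℕ} (α : DiffForm E M V n) (x : M)
    (v : Fin (n + 1) → TangentSpace 𝓘(ℝ, E) x) :
    d α x v = extDeriv (chartForm α x) (extChartAt 𝓘(ℝ, E) x x)
      (fun i ↦ chartDeriv x (v i)) := rfl

theorem mfderivWithin_range_extChartAt_symm (x : M) (y : E) :
    mfderivWithin 𝓘(ℝ, E) 𝓘(ℝ, E) (extChartAt 𝓘(ℝ, E) x).symm (Set.range 𝓘(ℝ, E)) y
      = chartSymmDeriv x y := by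
  rw [show Set.range 𝓘(ℝ, E) = Set.univ by simp, mfderivWithin_univ]
  rfl

theorem mlieBracket_eq (X Y : Π x : M, TangentSpace 𝓘(ℝ, E) x) (x : M) :
    VectorField.mlieBracket 𝓘(ℝ, E) X Y x = (chartDeriv (E := E) x).inverse
      (VectorField.lieBracket ℝ (chartField X x) (chartField Y x)
        (extChartAt 𝓘(ℝ, E) x x)) := by
  rw [← VectorField.mlieBracketWithin_univ, VectorField.mlieBracketWithin_apply,
    show (extChartAt 𝓘(ℝ, E) x).symm ⁻¹' Set.univ ∩ Set.range 𝓘(ℝ, E) = Set.univ by simp]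
  exact congr((chartDeriv (E := E) x).inverse
    ($(VectorField.lieBracketWithin_univ (𝕜 := ℝ) (V := chartField X x) (W := chartField Y x))
      (extChartAt 𝓘(ℝ, E) x x)))

variable [IsManifold 𝓘(ℝ, E) ∞ M]

theorem isInvertible_chartSymmDeriv {x : M} {y : E}
    (hy : y ∈ (extChartAt 𝓘(ℝ, E) x).target) : (chartSymmDeriv x y).IsInvertible := by
  have : IsManifold 𝓘(ℝ, E) 1 M := IsManifold.of_le (n := ∞) (by simp)
  have h := isInvertible_mfderivWithin_extChartAt_symm (I := 𝓘(ℝ, E)) hy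
  rw [mfderivWithin_range_extChartAt_symm] at h
  exact h

theorem chartSymmDeriv_chartField (X : Π x : M, TangentSpace 𝓘(ℝ, E) x) {x p : M} {y : E}
    (hy : y ∈ (extChartAt 𝓘(ℝ, E) x).target) (hp : (extChartAt 𝓘(ℝ, E) x).symm y = p) :
    chartSymmDeriv x y (chartField X x y) = X p := by
  subst hp
  have h2 := (isInvertible_chartSymmDeriv hy).self_apply_inverse
    (X ((extChartAt 𝓘(ℝ, E) x).symm y))
  rw [← h2, ← mfderivWithin_range_extChartAt_symm]
  rfl

theorem chartSymmDeriv_chartDeriv (x : M) (v : E) :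
    chartSymmDeriv x (extChartAt 𝓘(ℝ, E) x x) (chartDeriv x v) = v := by
  have : IsManifold 𝓘(ℝ, E) 1 M := IsManifold.of_le (n := ∞) (by simp)
  have h2 := mfderivWithin_extChartAt_symm_comp_mfderiv_extChartAt' (I := 𝓘(ℝ, E))
    (mem_extChartAt_source x)
  rw [mfderivWithin_range_extChartAt_symm] at h2
  exact congr($h2 v)

theorem chartDeriv_apply (X : Π x : M, TangentSpace 𝓘(ℝ, E) x) (x : M) :
    chartDeriv (E := E) x (X x) = chartField X x (extChartAt 𝓘(ℝ, E) x x) := by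
  have h0 := mem_extChartAt_target (I := 𝓘(ℝ, E)) x
  obtain ⟨e, he⟩ := isInvertible_chartSymmDeriv h0
  have h1 := (chartSymmDeriv_chartDeriv (E := E) x (X x)).trans
    (chartSymmDeriv_chartField X h0 (extChartAt_to_inv x)).symm
  rw [← he] at h1
  exact e.injective h1

/-- The manifold bracket is by definition the bracket of the chart expressions carried back by the
inverse of the chart derivative; this identifies that inverse with the derivative of the inverse
chart, the map that occurs in `chartForm`. -/
theorem chartSymmDeriv_lieBracket (X Y : Π x : M, TangentSpace 𝓘(ℝ, E) x) (x : M) :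
    chartSymmDeriv x (extChartAt 𝓘(ℝ, E) x x)
      (VectorField.lieBracket ℝ (chartField X x) (chartField Y x) (extChartAt 𝓘(ℝ, E) x x))
    = VectorField.mlieBracket 𝓘(ℝ, E) X Y x := by
  have : IsManifold 𝓘(ℝ, E) 1 M := IsManifold.of_le (n := ∞) (by simp)
  have h : (chartDeriv x : E →L[ℝ] E).IsInvertible :=
    isInvertible_mfderiv_extChartAt (I := 𝓘(ℝ, E)) (mem_extChartAt_source x)
  have h2 := h.self_apply_inverse (VectorField.lieBracket ℝ (chartField X x)
    (chartField Y x) (extChartAt 𝓘(ℝ, E) x x))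
  rw [mlieBracket_eq, ← h2, chartSymmDeriv_chartDeriv, h2]

theorem differentiableAt_chartField [CompleteSpace E] {X : Π x : M, TangentSpace 𝓘(ℝ, E) x}
    {x : M} (hX : MDiffAt (T% X) x) :
    DifferentiableAt ℝ (chartField X x) (extChartAt 𝓘(ℝ, E) x x) := by
  have : IsManifold 𝓘(ℝ, E) 2 M := IsManifold.of_le (n := ∞) (by norm_cast)
  have := (mdifferentiableWithinAt_univ.2 hX).differentiableWithinAt_mpullbackWithin_vectorField
  have h3 : (extChartAt 𝓘(ℝ, E) x).symm ⁻¹' Set.univ ∩ Set.range 𝓘(ℝ, E) = Set.univ := by simp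
  rw [h3] at this
  exact differentiableWithinAt_univ.1 this

theorem fderiv_comp_extChartAt_symm {f : M → ℝ} {x : M} (hf : MDiffAt f x) (v : E) :
    fderiv ℝ (f ∘ (extChartAt 𝓘(ℝ, E) x).symm) (extChartAt 𝓘(ℝ, E) x x) (chartDeriv x v)
      = mvfderiv 𝓘(ℝ, E) f x v := by
  have : IsManifold 𝓘(ℝ, E) 1 M := IsManifold.of_le (n := ∞) (by simp)
  have h1 : DifferentiableAt ℝ (f ∘ (extChartAt 𝓘(ℝ, E) x).symm) (extChartAt 𝓘(ℝ, E) x x) := by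
    have := (mdifferentiableWithinAt_univ.2 hf).differentiableWithinAt_comp_extChartAt_symm
    rw [show (extChartAt 𝓘(ℝ, E) x).symm ⁻¹' Set.univ ∩ Set.range 𝓘(ℝ, E) = Set.univ by simp]
      at this
    exact differentiableWithinAt_univ.1 this
  have h2 : f =ᶠ[𝓝 x] (f ∘ (extChartAt 𝓘(ℝ, E) x).symm) ∘ extChartAt 𝓘(ℝ, E) x := by
    filter_upwards [extChartAt_source_mem_nhds (I := 𝓘(ℝ, E)) x] with y hy
    simp only [Function.comp_apply, (extChartAt 𝓘(ℝ, E) x).left_inv hy]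
  have h3 := mfderiv_comp x h1.mdifferentiableAt
    (mdifferentiableAt_extChartAt (I := 𝓘(ℝ, E)) (mem_chart_source E x))
  have h4 := h2.mfderiv_eq (I := 𝓘(ℝ, E)) (I' := 𝓘(ℝ, ℝ))
  rw [h3, mfderiv_eq_fderiv] at h4
  exact congr($h4 v).symm

end ChartFields

/-! ### Cartan's formula for the exterior derivative of a two-form. -/

section ExteriorDerivative

variable {E : Type*} [NormedAddCommGroup E] [NormedSpace ℝ E] [CompleteSpace E]
  {M : Type*} [TopologicalSpace M] [ChartedSpace E M] [IsManifold 𝓘(ℝ, E) ∞ M]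

/-- The exterior derivative of a two-form evaluated on vector fields. -/
theorem d_apply_vectorField {α : DiffForm E M ℝ 2} {x : M}
    (hα : DifferentiableAt ℝ (chartForm α x) (extChartAt 𝓘(ℝ, E) x x))
    (hα' : ∀ X Y : Π x : M, TangentSpace 𝓘(ℝ, E) x, MDiffAt (T% X) x → MDiffAt (T% Y) x →
      MDiffAt (fun y ↦ α y ![X y, Y y]) x)
    {X Y Z : Π x : M, TangentSpace 𝓘(ℝ, E) x}
    (hX : MDiffAt (T% X) x) (hY : MDiffAt (T% Y) x) (hZ : MDiffAt (T% Z) x) :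
    d α x ![X x, Y x, Z x] =
      mvfderiv 𝓘(ℝ, E) (fun y ↦ α y ![Y y, Z y]) x (X x)
      - mvfderiv 𝓘(ℝ, E) (fun y ↦ α y ![X y, Z y]) x (Y x)
      + mvfderiv 𝓘(ℝ, E) (fun y ↦ α y ![X y, Y y]) x (Z x)
      - α x ![VectorField.mlieBracket 𝓘(ℝ, E) X Y x, Z x]
      + α x ![VectorField.mlieBracket 𝓘(ℝ, E) X Z x, Y x]
      - α x ![VectorField.mlieBracket 𝓘(ℝ, E) Y Z x, X x] := by
  set p := extChartAt 𝓘(ℝ, E) x x with hp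
  have hpt : p ∈ (extChartAt 𝓘(ℝ, E) x).target := mem_extChartAt_target (I := 𝓘(ℝ, E)) x
  have hpx : (extChartAt 𝓘(ℝ, E) x).symm p = x := extChartAt_to_inv x
  let W : Fin 3 → E → E := ![chartField X x, chartField Y x, chartField Z x]
  have hW : ∀ i, DifferentiableAt ℝ (W i) p := by
    intro i
    fin_cases i
    exacts [differentiableAt_chartField hX, differentiableAt_chartField hY,
      differentiableAt_chartField hZ]
  -- On the chart target the flat expression of `α` on the flat fields is `α(A, B)` composed with
  -- the inverse chart, so the derivatives at `p` agree. The fields enter through an arbitrary `u`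
  -- so that the `removeNth` tuples below match definitionally.
  have key : ∀ A B C : Π x : M, TangentSpace 𝓘(ℝ, E) x, MDiffAt (T% A) x → MDiffAt (T% B) x →
      ∀ u : Fin 2 → E → E, u 0 = chartField A x → u 1 = chartField B x →
      fderiv ℝ (fun y ↦ chartForm α x y (fun i ↦ u i y)) p (chartField C x p) =
        mvfderiv 𝓘(ℝ, E) (fun y ↦ α y ![A y, B y]) x (C x) := by
    intro A B C hA hB u hu0 hu1
    refine Eq.trans ?_ (fderiv_comp_extChartAt_symm (hα' A B hA hB) (C x))
    rw [chartDeriv_apply]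
    have : (fun y ↦ chartForm α x y (fun i ↦ u i y)) =ᶠ[𝓝 p]
        (fun y ↦ α y ![A y, B y]) ∘ (extChartAt 𝓘(ℝ, E) x).symm := by
      filter_upwards [extChartAt_target_mem_nhds (I := 𝓘(ℝ, E)) x] with y hy
      rw [chartForm_apply α rfl]
      congr 1
      ext i
      fin_cases i
      · simpa [hu0] using chartSymmDeriv_chartField A hy rfl
      · simpa [hu1] using chartSymmDeriv_chartField B hy rfl
    rw [this.fderiv_eq]
  have key2 : ∀ A B C : Π x : M, TangentSpace 𝓘(ℝ, E) x, ∀ u : Fin 2 → E,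
      u 0 = VectorField.lieBracket ℝ (chartField A x) (chartField B x) p →
      u 1 = chartField C x p →
      chartForm α x p u = α x ![VectorField.mlieBracket 𝓘(ℝ, E) A B x, C x] := by
    intro A B C u hu0 hu1
    rw [chartForm_apply α hpx]
    congr 1
    ext i
    fin_cases i
    · exact (congrArg _ hu0).trans (chartSymmDeriv_lieBracket A B x)
    · exact (congrArg _ hu1).trans (chartSymmDeriv_chartField C hpt hpx)
  have h1 : d α x ![X x, Y x, Z x] = extDeriv (chartForm α x) p (fun i ↦ W i p) := by
    rw [d_apply]
    congr 1
    ext i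
    fin_cases i
    exacts [chartDeriv_apply X x, chartDeriv_apply Y x, chartDeriv_apply Z x]
  rw [h1, extDeriv_apply_vectorField hα hW]
  -- The bracket terms run over `i ≤ j` in `Fin 2` and use the slots `castSucc i < succ j`: these
  -- are the pairs (0,1), (0,2), (1,2).
  have I0 : Finset.Ici (0 : Fin 2) = {0, 1} := by decide
  have I1 : Finset.Ici (1 : Fin 2) = {1} := by decide
  have k0 := key Y Z X hY hZ (fun j y ↦ (0 : Fin 3).removeNth (fun k ↦ W k y) j) rfl rfl
  have k1 := key X Z Y hX hZ (fun j y ↦ (1 : Fin 3).removeNth (fun k ↦ W k y) j) rfl rfl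
  have k2 := key X Y Z hX hY (fun j y ↦ (2 : Fin 3).removeNth (fun k ↦ W k y) j) rfl rfl
  have l00 := key2 X Y Z (Matrix.vecCons (VectorField.lieBracket ℝ (W (Fin.castSucc 0))
    (W (Fin.succ 0)) p) ((0 : Fin 2).removeNth <| (Fin.castSucc 0).removeNth (W · p))) rfl rfl
  have l01 := key2 X Z Y (Matrix.vecCons (VectorField.lieBracket ℝ (W (Fin.castSucc 0))
    (W (Fin.succ 1)) p) ((1 : Fin 2).removeNth <| (Fin.castSucc 0).removeNth (W · p))) rfl rfl
  have l11 := key2 Y Z X (Matrix.vecCons (VectorField.lieBracket ℝ (W (Fin.castSucc 1))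
    (W (Fin.succ 1)) p) ((1 : Fin 2).removeNth <| (Fin.castSucc 1).removeNth (W · p))) rfl rfl
  rw [Fin.sum_univ_three, Fin.sum_univ_two, I0, I1, Finset.sum_pair (by decide),
    Finset.sum_singleton, l00, l01, l11, ← k0, ← k1, ← k2]
  simp only [Fin.val_zero, Fin.val_one, Fin.val_two]
  simp only [W, Matrix.cons_val]
  ring

end ExteriorDerivative

/-! ### Differentiability of the Kähler form and Cartan's formula for it. -/

section KahlerForm

variable {E : Type*} [NormedAddCommGroup E] [NormedSpace ℝ E]

/-- The alternating form `(u, w) ↦ (B u w - B w u) / 2` attached to a bilinear form, as a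
continuous linear map. -/
noncomputable def alternatize₂ : (E →L[ℝ] E →L[ℝ] ℝ) →L[ℝ] E [⋀^Fin 2]→L[ℝ] ℝ :=
  (1 / 2 : ℝ) • (ContinuousAlternatingMap.alternatizeUncurryFinCLM ℝ E ℝ).comp
    (ContinuousLinearMap.compL ℝ E (E →L[ℝ] ℝ) (E [⋀^Fin 1]→L[ℝ] ℝ)
      (ContinuousAlternatingMap.ofSubsingletonLIE (𝕜 := ℝ) (E := E) (F := ℝ)
        (0 : Fin 1)).toContinuousLinearEquiv.toContinuousLinearMap)

theorem alternatize₂_apply {B : E →L[ℝ] E →L[ℝ] ℝ} (hB : ∀ u w, B u w = -B w u)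
    (v : Fin 2 → E) : alternatize₂ B v = B (v 0) (v 1) := by
  simp [alternatize₂, ContinuousAlternatingMap.alternatizeUncurryFin_apply, Fin.sum_univ_two,
    Fin.removeNth]
  rw [hB (v 1)]
  ring

theorem differentiableAt_clm_comp {F G : Type*} [NormedAddCommGroup F] [NormedSpace ℝ F]
    [NormedAddCommGroup G] [NormedSpace ℝ G] (L : F →L[ℝ] G) {B : E → F} {s : Set E} {x : E}
    (hs : s ∈ 𝓝 x) (hB : ContDiffOn ℝ ∞ B s) : DifferentiableAt ℝ (fun y ↦ L (B y)) x :=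
  L.differentiableAt.comp x ((hB.contDiffAt hs).differentiableAt (by simp))

-- In finite dimension, smoothness of the scalar components `B y u w` gives smoothness of `B`, and a
-- fixed continuous linear map carries it over to the alternating forms. This avoids differentiating
-- a form-valued map directly.
set_option synthInstance.maxHeartbeats 200000 in
theorem differentiableAt_alternatize₂ [FiniteDimensional ℝ E]
    {B : E → E →L[ℝ] E →L[ℝ] ℝ} {s : Set E}
    {x : E} (hs : s ∈ 𝓝 x) (hB : ∀ u w, ContDiffOn ℝ ∞ (fun y ↦ B y u w) s) :
    DifferentiableAt ℝ (fun y ↦ alternatize₂ (B y)) x := by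
  have h1 (u : E) : ContDiffOn ℝ ∞ (fun y ↦ B y u) s := contDiffOn_clm_apply.2 fun w ↦ hB u w
  have h2 : ContDiffOn ℝ ∞ B s := contDiffOn_clm_apply.2 h1
  exact differentiableAt_clm_comp alternatize₂ hs h2

variable {M : Type*} [TopologicalSpace M] [ChartedSpace E M] [IsManifold 𝓘(ℝ, E) ∞ M]

theorem contMDiffOn_chartSymmDeriv (x : M) (u : E) :
    ContMDiffOn 𝓘(ℝ, E) (𝓘(ℝ, E).prod 𝓘(ℝ, E)) ∞
      (fun y ↦ TotalSpace.mk' E (E := fun x : M ↦ TangentSpace 𝓘(ℝ, E) x)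
        ((extChartAt 𝓘(ℝ, E) x).symm y) (chartSymmDeriv x y u))
      (extChartAt 𝓘(ℝ, E) x).target := by
  have : IsManifold 𝓘(ℝ, E) 1 M := IsManifold.of_le (n := ∞) (by simp)
  have ho : IsOpen (extChartAt 𝓘(ℝ, E) x).target := isOpen_extChartAt_target (I := 𝓘(ℝ, E)) x
  have h1 := (contMDiffOn_extChartAt_symm (I := 𝓘(ℝ, E)) (n := ∞) x).contMDiffOn_tangentMapWithin
    (m := ∞) (by simp) ho.uniqueMDiffOn
  have h2 : ContMDiff 𝓘(ℝ, E) 𝓘(ℝ, E).tangent ∞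
      (fun y : E ↦ (⟨y, u⟩ : TangentBundle 𝓘(ℝ, E) E)) :=
    contMDiff_vectorSpace_iff_contDiff.2 contDiff_const
  have h3 := h1.comp h2.contMDiffOn (fun y hy ↦ hy)
  refine h3.congr fun y hy ↦ ?_
  simp only [Function.comp_apply, tangentMapWithin, mfderivWithin_of_isOpen ho hy]
  rfl

theorem IsHermitian.differentiableAt_chartForm [FiniteDimensional ℝ E] {g : Metric E M}
    {S : ComplexStructure E M} (h : IsHermitian g S) (x : M) :
    DifferentiableAt ℝ (chartForm (kahlerForm h) x) (extChartAt 𝓘(ℝ, E) x x) := by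
  let ψ := (extChartAt 𝓘(ℝ, E) x).symm
  let B : E → E →L[ℝ] E →L[ℝ] ℝ := fun y ↦
    ContinuousLinearMap.bilinearComp (E := E) (F := E) (g.inner (ψ y))
      (ContinuousLinearMap.comp (M₂ := E) (S.J (ψ y)) (chartSymmDeriv x y)) (chartSymmDeriv x y)
  have hB : ∀ y u w, B y u w = g.inner (ψ y) (S.J (ψ y) (chartSymmDeriv x y u))
    (chartSymmDeriv x y w) := fun y u w ↦ rfl
  have h1 : chartForm (kahlerForm h) x = fun y ↦ alternatize₂ (B y) := by
    funext y
    ext v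
    rw [alternatize₂_apply]
    · rfl
    · intro u w
      exact (h.inner_apply_left (ψ y) _ _).trans (congrArg Neg.neg (g.symm (ψ y) _ _))
  rw [h1]
  refine differentiableAt_alternatize₂ (extChartAt_target_mem_nhds (I := 𝓘(ℝ, E)) x)
    fun u w ↦ ?_
  rw [← contMDiffOn_iff_contDiffOn]
  intro y hy
  have hψ : ContMDiffWithinAt 𝓘(ℝ, E) 𝓘(ℝ, E) ∞ ψ (extChartAt 𝓘(ℝ, E) x).target y :=
    contMDiffOn_extChartAt_symm x y hy
  have a1 := (S.contMDiff.contMDiffAt.comp_contMDiffWithinAt y hψ).clm_bundle_apply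
    (contMDiffOn_chartSymmDeriv x u y hy)
  have a2 := ContMDiffWithinAt.clm_bundle_apply₂ (F₁ := E) (F₂ := E) (F₃ := ℝ)
    (E₃ := Bundle.Trivial M ℝ) (g.contMDiff.contMDiffAt.comp_contMDiffWithinAt y hψ) a1
    (contMDiffOn_chartSymmDeriv x w y hy)
  simp only [contMDiffWithinAt_totalSpace] at a2
  exact a2.2

theorem IsHermitian.d_kahlerForm_apply [FiniteDimensional ℝ E] [CompleteSpace E] {g : Metric E M}
    {S : ComplexStructure E M} (h : IsHermitian g S) {x : M}
    {X Y Z : Π x : M, TangentSpace 𝓘(ℝ, E) x}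
    (hX : MDiffAt (T% X) x) (hY : MDiffAt (T% Y) x) (hZ : MDiffAt (T% Z) x) :
    d (kahlerForm h) x ![X x, Y x, Z x] =
      mvfderiv 𝓘(ℝ, E) (fun y ↦ g.inner y (S.J y (Y y)) (Z y)) x (X x)
      - mvfderiv 𝓘(ℝ, E) (fun y ↦ g.inner y (S.J y (X y)) (Z y)) x (Y x)
      + mvfderiv 𝓘(ℝ, E) (fun y ↦ g.inner y (S.J y (X y)) (Y y)) x (Z x)
      - g.inner x (S.J x (VectorField.mlieBracket 𝓘(ℝ, E) X Y x)) (Z x)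
      + g.inner x (S.J x (VectorField.mlieBracket 𝓘(ℝ, E) X Z x)) (Y x)
      - g.inner x (S.J x (VectorField.mlieBracket 𝓘(ℝ, E) Y Z x)) (X x) :=
  d_apply_vectorField (h.differentiableAt_chartForm x)
    (fun _ _ hX hY ↦ mdifferentiableAt_inner g (S.mdifferentiableAt_apply hX) hY) hX hY hZ

end KahlerForm

/-! ### `dF` and the Nijenhuis tensor in terms of `∇J` and torsion. -/

section Parallel

variable {E : Type*} [NormedAddCommGroup E] [NormedSpace ℝ E]
  {M : Type*} [TopologicalSpace M] [ChartedSpace E M] [IsManifold 𝓘(ℝ, E) ∞ M]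

theorem cov_neg (cov : Connection E M) {Y : Π x : M, TangentSpace 𝓘(ℝ, E) x} {x : M}
    (hY : MDiffAt (T% Y) x) : cov (fun y ↦ -Y y) x = -cov Y x := by
  have := cov.isCovariantDerivativeOnUniv.smul_const (-1 : ℝ) hY
  rw [neg_one_smul, neg_one_smul] at this
  exact this

/-- The covariant derivative of `J`, contracted with the metric: `g((∇_X J) Y, Z)`. -/
noncomputable def covJ (g : Metric E M) (S : ComplexStructure E M) (cov : Connection E M)
    (x : M) (u : TangentSpace 𝓘(ℝ, E) x) (Y : Π x : M, TangentSpace 𝓘(ℝ, E) x)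
    (w : TangentSpace 𝓘(ℝ, E) x) : ℝ :=
  g.inner x (cov (fun y ↦ S.J y (Y y)) x u) w - g.inner x (S.J x (cov Y x u)) w

variable {g : Metric E M} {S : ComplexStructure E M} {cov : Connection E M}

theorem covJ_neg_left (x : M) (u : TangentSpace 𝓘(ℝ, E) x)
    (Y : Π x : M, TangentSpace 𝓘(ℝ, E) x) (w : TangentSpace 𝓘(ℝ, E) x) :
    covJ g S cov x (-u) Y w = -covJ g S cov x u Y w := by
  simp only [covJ, map_neg, neg_apply]
  ring

theorem covJ_neg_right (x : M) (u : TangentSpace 𝓘(ℝ, E) x)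
    (Y : Π x : M, TangentSpace 𝓘(ℝ, E) x) (w : TangentSpace 𝓘(ℝ, E) x) :
    covJ g S cov x u Y (-w) = -covJ g S cov x u Y w := by
  simp only [covJ, map_neg]
  ring

theorem IsMetric.mvfderiv_apply (hm : IsMetric g cov) {X Y : Π x : M, TangentSpace 𝓘(ℝ, E) x}
    {x : M} (hX : MDiffAt (T% X) x) (hY : MDiffAt (T% Y) x) (v : TangentSpace 𝓘(ℝ, E) x) :
    mvfderiv 𝓘(ℝ, E) (fun y ↦ g.inner y (X y) (Y y)) x v
      = g.inner x (cov X x v) (Y x) + g.inner x (X x) (cov Y x v) :=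
  hm X Y x hX hY v

/-- Differentiate `g(JY, Z) = -g(Y, JZ)` using `∇g = 0`. -/
theorem covJ_skew (h : IsHermitian g S) (hm : IsMetric g cov) {x : M}
    (u : TangentSpace 𝓘(ℝ, E) x) {Y Z : Π x : M, TangentSpace 𝓘(ℝ, E) x}
    (hY : MDiffAt (T% Y) x) (hZ : MDiffAt (T% Z) x) :
    covJ g S cov x u Y (Z x) = -covJ g S cov x u Z (Y x) := by
  have h1 := hm.mvfderiv_apply (S.mdifferentiableAt_apply hY) hZ u
  have h2 := hm.mvfderiv_apply hY (S.mdifferentiableAt_apply hZ) u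
  have h3 : (fun y ↦ g.inner y (S.J y (Y y)) (Z y)) = -fun y ↦ g.inner y (Y y) (S.J y (Z y)) := by
    funext y
    exact h.inner_apply_left y _ _
  have h4 : mvfderiv 𝓘(ℝ, E) (fun y ↦ g.inner y (S.J y (Y y)) (Z y)) x u =
      -mvfderiv 𝓘(ℝ, E) (fun y ↦ g.inner y (Y y) (S.J y (Z y))) x u := by
    rw [h3, mvfderiv_neg]
    rfl
  have h5 := h4
  rw [h1, h2] at h5
  simp only [covJ, h.inner_apply_left x (cov _ x u)]
  rw [g.symm x (cov (fun y ↦ S.J y (Z y)) x u), g.symm x (cov Z x u)]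
  linarith

/-- Differentiating `J² = -1` gives `(∇J)J = -J(∇J)`, and the skew-adjointness of `J` moves the
outer `J` onto `w`. -/
theorem covJ_apply_left (h : IsHermitian g S) {x : M}
    (u w : TangentSpace 𝓘(ℝ, E) x) {Y : Π x : M, TangentSpace 𝓘(ℝ, E) x}
    (hY : MDiffAt (T% Y) x) :
    covJ g S cov x u (fun y ↦ S.J y (Y y)) w = covJ g S cov x u Y (S.J x w) := by
  have h1 : (fun y ↦ S.J y (S.J y (Y y))) = fun y ↦ -Y y := funext fun y ↦ S.sq y _
  simp only [covJ, h1, cov_neg cov hY, h x]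
  rw [h.inner_apply_left]
  simp only [neg_apply, map_neg]
  ring

variable [FiniteDimensional ℝ E] [CompleteSpace E]

theorem mlieBracket_eq_sub_torsion (cov : Connection E M)
    {X Y : Π x : M, TangentSpace 𝓘(ℝ, E) x} {x : M} (hX : MDiffAt (T% X) x)
    (hY : MDiffAt (T% Y) x) : VectorField.mlieBracket 𝓘(ℝ, E) X Y x =
      cov Y x (X x) - cov X x (Y x) - cov.torsion x (X x) (Y x) := by
  have : IsManifold 𝓘(ℝ, E) 2 M := IsManifold.of_le (n := ∞) (by norm_cast)
  rw [cov.torsion_apply hX hY]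
  abel

/-- In Cartan's formula, `∇g = 0` expands the derivatives and each bracket becomes `∇_X Y - ∇_Y X -
T(X, Y)`. The covariant derivatives assemble into `∇J`, and only torsion is left over. -/
theorem d_kahlerForm_eq (h : IsHermitian g S) (hm : IsMetric g cov) {x : M}
    {X Y Z : Π x : M, TangentSpace 𝓘(ℝ, E) x}
    (hX : MDiffAt (T% X) x) (hY : MDiffAt (T% Y) x) (hZ : MDiffAt (T% Z) x) :
    d (kahlerForm h) x ![X x, Y x, Z x] =
      covJ g S cov x (X x) Y (Z x) - covJ g S cov x (Y x) X (Z x) + covJ g S cov x (Z x) X (Y x)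
      - torsionTensor g cov x (S.J x (X x)) (Y x) (Z x)
      + torsionTensor g cov x (S.J x (Y x)) (X x) (Z x)
      - torsionTensor g cov x (S.J x (Z x)) (X x) (Y x) := by
  have a := hm.mvfderiv_apply (S.mdifferentiableAt_apply hY) hZ (X x)
  have b := hm.mvfderiv_apply (S.mdifferentiableAt_apply hX) hZ (Y x)
  have c := hm.mvfderiv_apply (S.mdifferentiableAt_apply hX) hY (Z x)
  have sw : ∀ u v, g.inner x (S.J x u) v = -g.inner x (S.J x v) u := fun u v ↦ by
    rw [h.inner_apply_left, g.symm]
  rw [h.d_kahlerForm_apply hX hY hZ]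
  rw [a, b, c, mlieBracket_eq_sub_torsion cov hX hY, mlieBracket_eq_sub_torsion cov hX hZ,
    mlieBracket_eq_sub_torsion cov hY hZ]
  simp only [covJ, torsionTensor, map_sub, sub_apply]
  rw [sw (Y x) (cov Z x (X x)), sw (X x) (cov Z x (Y x)), sw (X x) (cov Y x (Z x)),
    sw (X x) (cov.torsion x _ _), sw (Y x) (cov.torsion x _ _), sw (Z x) (cov.torsion x _ _)]
  ring

/-- The vanishing Nijenhuis tensor paired with `w`, after the same replacement of brackets. For
parallel `J` the left side vanishes, and what is left is an algebraic constraint on the torsion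
alone. -/
theorem nijenhuis_eq (h : IsHermitian g S) {x : M}
    {X Y : Π x : M, TangentSpace 𝓘(ℝ, E) x}
    (hX : MDiffAt (T% X) x) (hY : MDiffAt (T% Y) x) (w : TangentSpace 𝓘(ℝ, E) x) :
    covJ g S cov x (S.J x (X x)) Y w - covJ g S cov x (S.J x (Y x)) X w
      + covJ g S cov x (X x) Y (S.J x w) - covJ g S cov x (Y x) X (S.J x w) =
    torsionTensor g cov x w (S.J x (X x)) (S.J x (Y x))
      + torsionTensor g cov x (S.J x w) (S.J x (X x)) (Y x)
      + torsionTensor g cov x (S.J x w) (X x) (S.J x (Y x))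
      - torsionTensor g cov x w (X x) (Y x) := by
  have hJX := S.mdifferentiableAt_apply hX
  have hJY := S.mdifferentiableAt_apply hY
  have n := congrArg (fun z ↦ g.inner x z w) (S.integrable X Y x hX hY)
  rw [mlieBracket_eq_sub_torsion cov hX hY, mlieBracket_eq_sub_torsion cov hJX hY,
    mlieBracket_eq_sub_torsion cov hX hJY, mlieBracket_eq_sub_torsion cov hJX hJY] at n
  have sw : ∀ u, g.inner x u (S.J x w) = -g.inner x (S.J x u) w := fun u ↦ by
    rw [h.inner_apply_left, neg_neg]
  simp only [map_sub, map_add, sub_apply, add_apply, map_zero, zero_apply] at n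
  simp only [covJ, torsionTensor, sw, S.sq, g.symm x w, g.symm x (S.J x w), map_neg,
    neg_apply]
  linarith

end Parallel

/-! ### The torsion of the Bismut connection. -/

section BismutTorsion

variable {E : Type*} [NormedAddCommGroup E] [NormedSpace ℝ E]
  {M : Type*} [TopologicalSpace M] [ChartedSpace E M]

theorem act_apply {V : Type*} [NormedAddCommGroup V] [NormedSpace ℝ V] (J : EndField E M) {n : ℕ}
    (α : DiffForm E M V n) (x : M) (v : Fin n → TangentSpace 𝓘(ℝ, E) x) :
    act J α x v = (-1 : ℝ) ^ n • α x (fun i ↦ J x (v i)) := rfl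

variable [IsManifold 𝓘(ℝ, E) ∞ M]
  {g : Metric E M} {S : ComplexStructure E M} {cov : Connection E M}

theorem act_kahlerForm (h : IsHermitian g S) : act S.J (kahlerForm h) = kahlerForm h := by
  funext x
  ext v
  rw [act_apply, kahlerForm_apply, kahlerForm_apply, h x]
  simp

theorem dc_kahlerForm_apply (h : IsHermitian g S) (x : M)
    (v : Fin 3 → TangentSpace 𝓘(ℝ, E) x) :
    dc S.J (kahlerForm h) x v = -d (kahlerForm h) x (fun i ↦ S.J x (v i)) := by
  have h1 : dc S.J (kahlerForm h) x v = (-1 : ℝ) ^ 2 • act S.J (d (act S.J (kahlerForm h))) x v :=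
    rfl
  rw [h1, act_kahlerForm, act_apply]
  norm_num

theorem eq_of_inner_eq (g : Metric E M) {x : M} {u v : TangentSpace 𝓘(ℝ, E) x}
    (h : ∀ w, g.inner x u w = g.inner x v w) : u = v := by
  by_contra hne
  have := g.pos x (u - v) (sub_ne_zero.2 hne)
  rw [map_sub (g.inner x), sub_apply, h, sub_self] at this
  exact lt_irrefl _ this

variable [FiniteDimensional ℝ E] [CompleteSpace E]

theorem covJ_eq_zero (h : IsHermitian g S) (hm : IsMetric g cov) (hs : HasSkewTorsion g cov)
    (hc : ∀ (x : M) (u v w : TangentSpace 𝓘(ℝ, E) x),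
      torsionTensor g cov x u v w = -dc S.J (kahlerForm h) x ![u, v, w])
    {x : M} {X Y Z : Π x : M, TangentSpace 𝓘(ℝ, E) x}
    (hX : MDiffAt (T% X) x) (hY : MDiffAt (T% Y) x) (hZ : MDiffAt (T% Z) x) :
    covJ g S cov x (X x) Y (Z x) = 0 := by
  have sw₁ : ∀ u v w, torsionTensor g cov x u v w = -torsionTensor g cov x v u w :=
    fun u v w ↦ (hs x u v w).1
  have sw₂ : ∀ u v w, torsionTensor g cov x u v w = -torsionTensor g cov x u w v :=
    fun u v w ↦ (hs x u v w).2
  have neg₁ : ∀ u v w, torsionTensor g cov x (-u) v w = -torsionTensor g cov x u v w :=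
    fun u v w ↦ by simp [torsionTensor]
  have neg₂ : ∀ u v w, torsionTensor g cov x u (-v) w = -torsionTensor g cov x u v w :=
    fun u v w ↦ by simp [torsionTensor]
  have neg₃ : ∀ u v w, torsionTensor g cov x u v (-w) = -torsionTensor g cov x u v w :=
    fun u v w ↦ by simp [torsionTensor]
  -- The hypothesis reads `c = dF(J·, J·, J·)`; since `J² = -1`, a further substitution of `J` into
  -- a three-form inverts it up to a sign.
  have hd : ∀ u v w, d (kahlerForm h) x ![u, v, w] =
      -torsionTensor g cov x (S.J x u) (S.J x v) (S.J x w) := by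
    intro u v w
    rw [hc, dc_kahlerForm_apply, neg_neg]
    have : (fun i ↦ S.J x ((![S.J x u, S.J x v, S.J x w] : Fin 3 → TangentSpace 𝓘(ℝ, E) x) i))
        = ![-u, -v, -w] := by
      ext i
      fin_cases i <;> exact S.sq x _
    rw [this]
    have e : (![-u, -v, -w] : Fin 3 → TangentSpace 𝓘(ℝ, E) x) = fun i ↦ (-1 : ℝ) • ![u, v, w] i := by
      ext i
      fin_cases i <;> simp
    rw [e, ContinuousAlternatingMap.map_smul_univ]
    norm_num
  -- Compare `dF(JX, JY, Z)` with the Nijenhuis identity for `X`, `JY`, `Z`: the terms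
  -- differentiating along `JX` and `JY` agree, and the torsion terms cancel by skewness.
  have key : ∀ {X Y Z : Π x : M, TangentSpace 𝓘(ℝ, E) x}, MDiffAt (T% X) x → MDiffAt (T% Y) x →
      MDiffAt (T% Z) x → covJ g S cov x (Y x) X (Z x) - covJ g S cov x (X x) Y (Z x)
        + covJ g S cov x (Z x) X (Y x) = 0 := by
    intro X Y Z hX hY hZ
    have hJX := S.mdifferentiableAt_apply hX
    have hJY := S.mdifferentiableAt_apply hY
    have e1 := d_kahlerForm_eq h hm hJX hJY hZ
    have e2 := nijenhuis_eq (cov := cov) h hX hJY (Z x)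
    rw [hd] at e1
    simp only [S.sq, covJ_neg_left, covJ_neg_right, covJ_apply_left h _ _ hX,
      covJ_apply_left h _ _ hY, neg₁, neg₂, neg₃] at e1 e2
    linarith [sw₁ (S.J x (Z x)) (X x) (Y x), sw₂ (X x) (S.J x (Z x)) (Y x),
      sw₂ (Z x) (S.J x (X x)) (Y x), sw₁ (Z x) (Y x) (S.J x (X x)),
      sw₂ (Y x) (Z x) (S.J x (X x)), sw₁ (Z x) (X x) (S.J x (Y x)),
      sw₂ (X x) (Z x) (S.J x (Y x))]
  -- With `a`, `b`, `c` the cyclic values of `A(X; Y, Z)`, skewness in the last two slots turns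
  -- these into `c = a + b`, `a = b + c`, `b = a + c`, whence all vanish.
  have k1 := key hX hY hZ
  have k2 := key hY hZ hX
  have k3 := key hZ hX hY
  have s1 := covJ_skew h hm (X x) hY hZ
  have s2 := covJ_skew h hm (Y x) hX hZ
  have s3 := covJ_skew h hm (Z x) hX hY
  linarith

/-- A metric connection with skew torsion preserves `J` if and only if its torsion is
`-dᶜF`. -/
theorem isParallel_iff (h : IsHermitian g S) (hm : IsMetric g cov) (hs : HasSkewTorsion g cov) :
    IsParallel cov S.J ↔ ∀ (x : M) (u v w : TangentSpace 𝓘(ℝ, E) x),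
      torsionTensor g cov x u v w = -dc S.J (kahlerForm h) x ![u, v, w] := by
  have : IsManifold 𝓘(ℝ, E) 1 M := IsManifold.of_le (n := ∞) (by simp)
  constructor
  · intro hp x u v w
    have h0 : ∀ (a b : TangentSpace 𝓘(ℝ, E) x) {Y : Π x : M, TangentSpace 𝓘(ℝ, E) x},
        MDiffAt (T% Y) x → covJ g S cov x a Y b = 0 := by
      intro a b Y hY
      rw [covJ, hp Y x hY, sub_self]
    let X := FiberBundle.extend E u
    let Y := FiberBundle.extend E v
    let Z := FiberBundle.extend E w
    have hX : MDiffAt (T% X) x := FiberBundle.mdifferentiableAt_extend 𝓘(ℝ, E) E u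
    have hY : MDiffAt (T% Y) x := FiberBundle.mdifferentiableAt_extend 𝓘(ℝ, E) E v
    have hZ : MDiffAt (T% Z) x := FiberBundle.mdifferentiableAt_extend 𝓘(ℝ, E) E w
    have hXu : X x = u := FiberBundle.extend_apply_self E u
    have hYv : Y x = v := FiberBundle.extend_apply_self E v
    have hZw : Z x = w := FiberBundle.extend_apply_self E w
    have hJX := S.mdifferentiableAt_apply hX
    have hJY := S.mdifferentiableAt_apply hY
    have hJZ := S.mdifferentiableAt_apply hZ
    have e1 := d_kahlerForm_eq h hm hJX hJY hJZ
    have e2 := nijenhuis_eq (cov := cov) h hX hY (Z x)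
    rw [h0 _ _ hJX, h0 _ _ hJX, h0 _ _ hJY] at e1
    rw [h0 _ _ hX, h0 _ _ hX, h0 _ _ hY, h0 _ _ hY] at e2
    rw [hXu, hYv, hZw] at e1 e2
    have neg₁ : ∀ u v w, torsionTensor g cov x (-u) v w = -torsionTensor g cov x u v w :=
      fun u v w ↦ by simp [torsionTensor]
    simp only [S.sq, neg₁] at e1
    have e3 : (fun i ↦ S.J x ((![u, v, w] : Fin 3 → TangentSpace 𝓘(ℝ, E) x) i))
        = ![S.J x u, S.J x v, S.J x w] := by
      ext i
      fin_cases i <;> rfl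
    rw [dc_kahlerForm_apply, e3, e1]
    -- By `e1`, `dF(Ju, Jv, Jw)` is the cyclic sum of `c(u, Jv, Jw)`; by integrability `e2`, that
    -- sum is `c(u, v, w)`. The listed facts only reorder arguments.
    linarith [(hs x w (S.J x u) (S.J x v)).1, (hs x (S.J x u) w (S.J x v)).2,
      (hs x (S.J x w) (S.J x u) v).1, (hs x (S.J x u) (S.J x w) v).2,
      (hs x (S.J x u) v (S.J x w)).1, (hs x (S.J x w) u (S.J x v)).1,
      (hs x u (S.J x w) (S.J x v)).2, (hs x w u v).1, (hs x u w v).2,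
      (hs x (S.J x u) (S.J x v) w).1]
  · intro hc Y x hY v
    refine eq_of_inner_eq g fun w ↦ ?_
    have := covJ_eq_zero h hm hs hc (FiberBundle.mdifferentiableAt_extend 𝓘(ℝ, E) E v) hY
      (FiberBundle.mdifferentiableAt_extend 𝓘(ℝ, E) E w)
    rw [FiberBundle.extend_apply_self, FiberBundle.extend_apply_self] at this
    exact sub_eq_zero.1 this

end BismutTorsion

/-! ### The Koszul expression with prescribed torsion. -/

section Koszul

variable {E : Type*} [NormedAddCommGroup E] [NormedSpace ℝ E]
  {M : Type*} [TopologicalSpace M] [ChartedSpace E M]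

section ThreeForm

variable {x : M}

theorem form₃_add₀ (c : DiffForm E M ℝ 3) (u u' v w : TangentSpace 𝓘(ℝ, E) x) :
    c x ![u + u', v, w] = c x ![u, v, w] + c x ![u', v, w] := by
  simpa using (c x).map_vecCons_add ![v, w] u u'

theorem form₃_smul₀ (c : DiffForm E M ℝ 3) (r : ℝ) (u v w : TangentSpace 𝓘(ℝ, E) x) :
    c x ![r • u, v, w] = r * c x ![u, v, w] := by
  simpa using (c x).map_vecCons_smul ![v, w] r u

theorem form₃_swap₀₁ (c : DiffForm E M ℝ 3) (u v w : TangentSpace 𝓘(ℝ, E) x) :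
    c x ![u, v, w] = -c x ![v, u, w] := by
  have := (c x).toAlternatingMap.map_swap ![v, u, w] (i := 0) (j := 1) (by decide)
  have e : (![v, u, w] : Fin 3 → TangentSpace 𝓘(ℝ, E) x) ∘ Equiv.swap 0 1 = ![u, v, w] := by
    ext i
    fin_cases i <;> rfl
  rw [e] at this
  exact this

theorem form₃_swap₁₂ (c : DiffForm E M ℝ 3) (u v w : TangentSpace 𝓘(ℝ, E) x) :
    c x ![u, v, w] = -c x ![u, w, v] := by
  have := (c x).toAlternatingMap.map_swap ![u, w, v] (i := 1) (j := 2) (by decide)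
  have e : (![u, w, v] : Fin 3 → TangentSpace 𝓘(ℝ, E) x) ∘ Equiv.swap 1 2 = ![u, v, w] := by
    ext i
    fin_cases i <;> rfl
  rw [e] at this
  exact this

/-- Brings any slot to the front, where `form₃_add₀` and `form₃_smul₀` give linearity. -/
theorem form₃_rotate (c : DiffForm E M ℝ 3) (u v w : TangentSpace 𝓘(ℝ, E) x) :
    c x ![u, v, w] = c x ![v, w, u] := by
  rw [form₃_swap₀₁, form₃_swap₁₂, neg_neg]

end ThreeForm

variable [IsManifold 𝓘(ℝ, E) ∞ M]

/-- The directional derivative `u(g(X, Y))` of the inner product of two vector fields. -/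
noncomputable def innerDeriv (g : Metric E M) (X Y : Π x : M, TangentSpace 𝓘(ℝ, E) x)
    (x : M) (u : TangentSpace 𝓘(ℝ, E) x) : ℝ :=
  mvfderiv 𝓘(ℝ, E) (fun y ↦ g.inner y (X y) (Y y)) x u

theorem innerDeriv_comm (g : Metric E M) (X Y : Π x : M, TangentSpace 𝓘(ℝ, E) x)
    (x : M) (u : TangentSpace 𝓘(ℝ, E) x) : innerDeriv g X Y x u = innerDeriv g Y X x u := by
  simp only [innerDeriv, g.symm _ (X _)]

variable (g : Metric E M) {X X' Y : Π x : M, TangentSpace 𝓘(ℝ, E) x} {x : M}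

theorem innerDeriv_add_left (hX : MDiffAt (T% X) x) (hX' : MDiffAt (T% X') x)
    (hY : MDiffAt (T% Y) x) (u : TangentSpace 𝓘(ℝ, E) x) :
    innerDeriv g (X + X') Y x u = innerDeriv g X Y x u + innerDeriv g X' Y x u := by
  have h : (fun y ↦ g.inner y ((X + X') y) (Y y)) =
      (fun y ↦ g.inner y (X y) (Y y)) + fun y ↦ g.inner y (X' y) (Y y) := by
    funext y
    simp
  rw [innerDeriv, h, mvfderiv_add (mdifferentiableAt_inner g hX hY)
    (mdifferentiableAt_inner g hX' hY)]
  rfl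

theorem innerDeriv_add_right (hX : MDiffAt (T% X) x) (hX' : MDiffAt (T% X') x)
    (hY : MDiffAt (T% Y) x) (u : TangentSpace 𝓘(ℝ, E) x) :
    innerDeriv g Y (X + X') x u = innerDeriv g Y X x u + innerDeriv g Y X' x u := by
  rw [innerDeriv_comm, innerDeriv_add_left g hX hX' hY, innerDeriv_comm, innerDeriv_comm g X']

theorem innerDeriv_smul_left {f : M → ℝ} (hf : MDiffAt f x) (hX : MDiffAt (T% X) x)
    (hY : MDiffAt (T% Y) x) (u : TangentSpace 𝓘(ℝ, E) x) :
    innerDeriv g (f • X) Y x u = f x * innerDeriv g X Y x u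
      + g.inner x (X x) (Y x) * mvfderiv 𝓘(ℝ, E) f x u := by
  have h : (fun y ↦ g.inner y ((f • X) y) (Y y)) = f * fun y ↦ g.inner y (X y) (Y y) := by
    funext y
    simp
  rw [innerDeriv, h, mvfderiv_mul hf (mdifferentiableAt_inner g hX hY)]
  rfl

theorem innerDeriv_smul_right {f : M → ℝ} (hf : MDiffAt f x) (hX : MDiffAt (T% X) x)
    (hY : MDiffAt (T% Y) x) (u : TangentSpace 𝓘(ℝ, E) x) :
    innerDeriv g Y (f • X) x u = f x * innerDeriv g Y X x u
      + g.inner x (X x) (Y x) * mvfderiv 𝓘(ℝ, E) f x u := by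
  rw [innerDeriv_comm, innerDeriv_smul_left g hf hX hY, innerDeriv_comm]

open VectorField in
/-- The Koszul expression for `2 g(∇_X Y, Z)`, where `∇` is the metric connection whose torsion
is the three-form `c`. -/
noncomputable def koszul (c : DiffForm E M ℝ 3) (X Y Z : Π x : M, TangentSpace 𝓘(ℝ, E) x)
    (x : M) : ℝ :=
  innerDeriv g Y Z x (X x) + innerDeriv g X Z x (Y x) - innerDeriv g X Y x (Z x)
    + g.inner x (mlieBracket 𝓘(ℝ, E) X Y x) (Z x) - g.inner x (mlieBracket 𝓘(ℝ, E) X Z x) (Y x)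
    - g.inner x (mlieBracket 𝓘(ℝ, E) Y Z x) (X x) + c x ![X x, Y x, Z x]

variable [CompleteSpace E] {Z : Π x : M, TangentSpace 𝓘(ℝ, E) x} (c : DiffForm E M ℝ 3)

/-- The derivatives of `f` produced by the inner products cancel those produced by the brackets, so
the expression depends on `X` only through its value at `x`. -/
theorem tensorialAt_koszul_left (hY : MDiffAt (T% Y) x) (hZ : MDiffAt (T% Z) x) :
    TensorialAt 𝓘(ℝ, E) E (fun X ↦ koszul g c X Y Z x) x where
  smul {f X} hf hX := by
    have : IsManifold 𝓘(ℝ, E) 2 M := IsManifold.of_le (n := ∞) (by norm_cast)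
    simp only [koszul, innerDeriv_smul_left g hf hX hZ, innerDeriv_smul_left g hf hX hY,
      VectorField.mlieBracket_smul_left hf hX, Pi.smul_apply', form₃_smul₀]
    simp only [innerDeriv, map_add, map_smul, add_apply, smul_apply, smul_eq_mul, map_neg,
      neg_apply, neg_smul]
    rw [g.symm x (X x) (Y x), g.symm x (X x) (Z x)]
    ring
  add {X X'} hX hX' := by
    have : IsManifold 𝓘(ℝ, E) 2 M := IsManifold.of_le (n := ∞) (by norm_cast)
    simp only [koszul, innerDeriv_add_left g hX hX' hZ, innerDeriv_add_left g hX hX' hY,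
      VectorField.mlieBracket_add_left hX hX', Pi.add_apply, form₃_add₀]
    simp only [innerDeriv, map_add, add_apply]
    ring

theorem tensorialAt_koszul_right (hX : MDiffAt (T% X) x) (hY : MDiffAt (T% Y) x) :
    TensorialAt 𝓘(ℝ, E) E (fun Z ↦ koszul g c X Y Z x) x where
  smul {f Z} hf hZ := by
    have : IsManifold 𝓘(ℝ, E) 2 M := IsManifold.of_le (n := ∞) (by norm_cast)
    have e : ∀ u v w, c x ![u, v, w] = c x ![w, u, v] := fun u v w ↦ (form₃_rotate c w u v).symm
    simp only [koszul, innerDeriv_smul_right g hf hZ hX, innerDeriv_smul_right g hf hZ hY,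
      VectorField.mlieBracket_smul_right hf hZ, Pi.smul_apply', e _ _ (_ • _), form₃_smul₀]
    simp only [innerDeriv, map_add, map_smul, add_apply, smul_apply, smul_eq_mul]
    rw [e (X x)]
    ring
  add {Z Z'} hZ hZ' := by
    have : IsManifold 𝓘(ℝ, E) 2 M := IsManifold.of_le (n := ∞) (by norm_cast)
    have e : ∀ u v w, c x ![u, v, w] = c x ![w, u, v] := fun u v w ↦ (form₃_rotate c w u v).symm
    simp only [koszul, innerDeriv_add_right g hZ hZ' hX, innerDeriv_add_right g hZ hZ' hY,
      VectorField.mlieBracket_add_right hZ hZ', Pi.add_apply, e _ _ (_ + _), form₃_add₀]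
    simp only [innerDeriv, map_add, add_apply]
    rw [e (X x), e (X x)]
    ring

/-- In this slot the `Zf` terms cancel but the two `Xf` terms add up; halved, they are the Leibniz
term of the connection. -/
theorem koszul_smul_middle {f : M → ℝ} (hf : MDiffAt f x) (hX : MDiffAt (T% X) x)
    (hY : MDiffAt (T% Y) x) (hZ : MDiffAt (T% Z) x) :
    koszul g c X (f • Y) Z x = f x * koszul g c X Y Z x
      + 2 * (mvfderiv 𝓘(ℝ, E) f x (X x) * g.inner x (Y x) (Z x)) := by
  have : IsManifold 𝓘(ℝ, E) 2 M := IsManifold.of_le (n := ∞) (by norm_cast)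
  have e : ∀ u v w, c x ![u, v, w] = c x ![v, w, u] := form₃_rotate c
  simp only [koszul, innerDeriv_smul_left g hf hY hZ, innerDeriv_smul_right g hf hY hX,
    VectorField.mlieBracket_smul_left hf hY, VectorField.mlieBracket_smul_right hf hY,
    Pi.smul_apply', e _ (_ • _), form₃_smul₀]
  simp only [innerDeriv, map_add, map_smul, add_apply, smul_apply, smul_eq_mul, map_neg,
      neg_apply, neg_smul]
  rw [e (X x)]
  ring

theorem koszul_add_middle {Y' : Π x : M, TangentSpace 𝓘(ℝ, E) x} (hX : MDiffAt (T% X) x)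
    (hY : MDiffAt (T% Y) x) (hY' : MDiffAt (T% Y') x) (hZ : MDiffAt (T% Z) x) :
    koszul g c X (Y + Y') Z x = koszul g c X Y Z x + koszul g c X Y' Z x := by
  have : IsManifold 𝓘(ℝ, E) 2 M := IsManifold.of_le (n := ∞) (by norm_cast)
  have e : ∀ u v w, c x ![u, v, w] = c x ![v, w, u] := form₃_rotate c
  simp only [koszul, innerDeriv_add_left g hY hY' hZ, innerDeriv_add_right g hY hY' hX,
    VectorField.mlieBracket_add_left hY hY', VectorField.mlieBracket_add_right hY hY',
    Pi.add_apply, e _ (_ + _), form₃_add₀]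
  simp only [innerDeriv, map_add, add_apply]
  rw [e (X x), e (X x)]
  ring

end Koszul

/-! ### The metric connection with a given three-form as torsion. -/

section KoszulConnection

variable {E : Type*} [NormedAddCommGroup E] [NormedSpace ℝ E]

variable {M : Type*} [TopologicalSpace M] [ChartedSpace E M]

section

variable [IsManifold 𝓘(ℝ, E) ∞ M]

theorem eq_of_inner_field_eq (g : Metric E M) {x : M} {u v : TangentSpace 𝓘(ℝ, E) x}
    (h : ∀ Z : Π x : M, TangentSpace 𝓘(ℝ, E) x, MDiffAt (T% Z) x →
      g.inner x u (Z x) = g.inner x v (Z x)) : u = v := by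
  have : IsManifold 𝓘(ℝ, E) 1 M := IsManifold.of_le (n := ∞) (by simp)
  refine eq_of_inner_eq g fun w ↦ ?_
  have := h _ (FiberBundle.mdifferentiableAt_extend 𝓘(ℝ, E) E w)
  rwa [FiberBundle.extend_apply_self] at this

theorem clm_eq_of_field_eq {x : M}
    {A B : TangentSpace 𝓘(ℝ, E) x →L[ℝ] TangentSpace 𝓘(ℝ, E) x}
    (h : ∀ X : Π x : M, TangentSpace 𝓘(ℝ, E) x, MDiffAt (T% X) x → A (X x) = B (X x)) :
    A = B := by
  have : IsManifold 𝓘(ℝ, E) 1 M := IsManifold.of_le (n := ∞) (by simp)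
  ext w
  have := h _ (FiberBundle.mdifferentiableAt_extend 𝓘(ℝ, E) E w)
  rwa [FiberBundle.extend_apply_self] at this

end

variable [FiniteDimensional ℝ E]

/-- Positivity gives injectivity, and `E` and its dual have equal dimension. It serves both the
metric itself and its Gram matrix in a local frame. -/
theorem exists_equiv_of_pos (B : E →L[ℝ] E →L[ℝ] ℝ) (hB : ∀ v, v ≠ 0 → 0 < B v v) :
    ∃ e : E ≃L[ℝ] (E →L[ℝ] ℝ), (e : E →L[ℝ] E →L[ℝ] ℝ) = B := by
  have hinj : Function.Injective B.toLinearMap := by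
    rw [injective_iff_map_eq_zero]
    intro v hv
    by_contra hne
    have h1 := hB v hne
    have h2 : B v = 0 := hv
    rw [h2] at h1
    exact lt_irrefl _ h1
  have hdim : Module.finrank ℝ E = Module.finrank ℝ (E →L[ℝ] ℝ) := by
    rw [← (LinearMap.toContinuousLinearMap (𝕜 := ℝ) (E := E) (F' := ℝ)).finrank_eq]
    exact (Subspace.dual_finrank_eq (K := ℝ) (V := E)).symm
  refine ⟨(LinearMap.linearEquivOfInjective B.toLinearMap hinj hdim).toContinuousLinearEquiv, ?_⟩
  ext v w
  rfl

theorem contMDiffAt_clm_of_apply {F : Type*} [NormedAddCommGroup F] [NormedSpace ℝ F]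
    {f : M → E →L[ℝ] F} {x : M} {n : WithTop ℕ∞}
    (hf : ∀ u, ContMDiffAt 𝓘(ℝ, E) 𝓘(ℝ, F) n (fun y ↦ f y u) x) :
    ContMDiffAt 𝓘(ℝ, E) 𝓘(ℝ, E →L[ℝ] F) n f x := by
  let b := Module.finBasis ℝ E
  have h : f = fun y ↦ ∑ i, ContinuousLinearMap.smulRightL ℝ E F
      (LinearMap.toContinuousLinearMap (b.coord i)) (f y (b i)) := by
    funext y
    ext v
    have h1 (i) : ContinuousLinearMap.smulRightL ℝ E F
      (LinearMap.toContinuousLinearMap (b.coord i)) (f y (b i)) v = b.repr v i • f y (b i) := rfl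
    simp only [sum_apply, h1]
    conv_lhs => rw [← b.sum_repr v, map_sum]
    simp only [map_smul]
  rw [h]
  refine contMDiffAt_finsetSum fun i _ ↦ ?_
  exact (ContinuousLinearMap.contDiff _).contDiffAt.comp_contMDiffAt (hf (b i))

variable [IsManifold 𝓘(ℝ, E) ∞ M]

theorem exists_metricEquiv (g : Metric E M) (x : M) :
    ∃ e : TangentSpace 𝓘(ℝ, E) x ≃L[ℝ] (TangentSpace 𝓘(ℝ, E) x →L[ℝ] ℝ),
      ∀ u v, e u v = g.inner x u v := by
  obtain ⟨e, he⟩ := exists_equiv_of_pos (E := E) (g.inner x) (g.pos x)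
  exact ⟨e, fun u v ↦ congr($he u v)⟩

/-- The identification of tangent and cotangent spaces by the metric. -/
noncomputable def metricEquiv (g : Metric E M) (x : M) :
    TangentSpace 𝓘(ℝ, E) x ≃L[ℝ] (TangentSpace 𝓘(ℝ, E) x →L[ℝ] ℝ) :=
  (exists_metricEquiv g x).choose

theorem metricEquiv_apply (g : Metric E M) (x : M) (u v : TangentSpace 𝓘(ℝ, E) x) :
    metricEquiv g x u v = g.inner x u v :=
  (exists_metricEquiv g x).choose_spec u v

variable [CompleteSpace E]

open Classical in
/-- The metric connection with torsion `c`, as a map on vector fields. -/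
noncomputable def koszulCov (g : Metric E M) (c : DiffForm E M ℝ 3)
    (Y : Π x : M, TangentSpace 𝓘(ℝ, E) x) (x : M) :
    TangentSpace 𝓘(ℝ, E) x →L[ℝ] TangentSpace 𝓘(ℝ, E) x :=
  have : IsManifold 𝓘(ℝ, E) 1 M := IsManifold.of_le (n := ∞) (by simp)
  if hY : MDiffAt (T% Y) x then
    (1 / 2 : ℝ) • ContinuousLinearMap.comp (metricEquiv g x).symm.toContinuousLinearMap
      (TensorialAt.mkHom₂ (I := 𝓘(ℝ, E)) (F := E) (F' := E) (fun X Z ↦ koszul g c X Y Z x) x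
        (fun _ hZ ↦ tensorialAt_koszul_left g c hY hZ)
        (fun _ hX ↦ tensorialAt_koszul_right g c hX hY))
  -- An arbitrary value: the axioms of a covariant derivative only concern sections differentiable
  -- at the point.
  else 0

theorem inner_koszulCov (g : Metric E M) (c : DiffForm E M ℝ 3)
    {X Y Z : Π x : M, TangentSpace 𝓘(ℝ, E) x} {x : M}
    (hX : MDiffAt (T% X) x) (hY : MDiffAt (T% Y) x) (hZ : MDiffAt (T% Z) x) :
    g.inner x (koszulCov g c Y x (X x)) (Z x) = 1 / 2 * koszul g c X Y Z x := by
  have : IsManifold 𝓘(ℝ, E) 1 M := IsManifold.of_le (n := ∞) (by simp)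
  rw [koszulCov, dif_pos hY, smul_apply, map_smul, smul_apply, smul_eq_mul]
  congr 1
  refine (metricEquiv_apply g x _ _).symm.trans ?_
  refine Eq.trans ?_ (TensorialAt.mkHom₂_apply (I := 𝓘(ℝ, E)) (F := E) (F' := E)
    (Φ := fun X Z ↦ koszul g c X Y Z x) (fun _ hZ ↦ tensorialAt_koszul_left g c hY hZ)
    (fun _ hX ↦ tensorialAt_koszul_right g c hX hY) hX hZ)
  exact congr($((metricEquiv g x).apply_symm_apply _) (Z x))

/-- The metric connection with torsion `c`. -/
noncomputable def koszulConnection (g : Metric E M) (c : DiffForm E M ℝ 3) : Connection E M where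
  toFun := koszulCov g c
  isCovariantDerivativeOnUniv :=
    { add := by
        intro Y Y' x hY hY' _
        have hs := mdifferentiableAt_add_section hY hY'
        refine clm_eq_of_field_eq fun X hX ↦ eq_of_inner_field_eq g fun Z hZ ↦ ?_
        rw [add_apply, map_add, add_apply, inner_koszulCov g c hX hs hZ,
          inner_koszulCov g c hX hY hZ, inner_koszulCov g c hX hY' hZ,
          koszul_add_middle g c hX hY hY' hZ, mul_add]
      leibniz := by
        intro Y f x hY hf _
        have hs := hf.smul_section hY
        refine clm_eq_of_field_eq fun X hX ↦ eq_of_inner_field_eq g fun Z hZ ↦ ?_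
        rw [add_apply, map_add, add_apply, inner_koszulCov g c hX hs hZ,
          koszul_smul_middle g c hf hX hY hZ, smul_apply, map_smul, smul_apply,
          inner_koszulCov g c hX hY hZ, ContinuousLinearMap.smulRight_apply, map_smul, smul_apply]
        simp only [smul_eq_mul]
        ring }

theorem koszulConnection_apply (g : Metric E M) (c : DiffForm E M ℝ 3) :
    (koszulConnection g c).toFun = koszulCov g c := rfl

theorem isMetric_koszulConnection (g : Metric E M) (c : DiffForm E M ℝ 3) :
    IsMetric g (koszulConnection g c) := by
  intro Y Z x hY hZ v
  have : IsManifold 𝓘(ℝ, E) 1 M := IsManifold.of_le (n := ∞) (by simp)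
  have hX := FiberBundle.mdifferentiableAt_extend 𝓘(ℝ, E) E v
  have h1 := inner_koszulCov g c hX hY hZ
  have h2 := inner_koszulCov g c hX hZ hY
  rw [FiberBundle.extend_apply_self] at h1 h2
  change innerDeriv g Y Z x v = g.inner x (koszulCov g c Y x v) (Z x)
    + g.inner x (Y x) (koszulCov g c Z x v)
  rw [g.symm x (Y x), h1, h2]
  -- Symmetrizing the Koszul expression in `Y`, `Z` kills the brackets and `c` and leaves twice the
  -- derivative of `g(Y, Z)`.
  rw [koszul, koszul, VectorField.mlieBracket_swap_apply (V := Z) (W := Y),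
    FiberBundle.extend_apply_self, form₃_swap₁₂ c v (Z x), innerDeriv_comm g Z Y]
  simp only [map_neg, neg_apply]
  ring

theorem torsionTensor_koszulConnection (g : Metric E M) (c : DiffForm E M ℝ 3) (x : M)
    (u v w : TangentSpace 𝓘(ℝ, E) x) :
    torsionTensor g (koszulConnection g c) x u v w = c x ![u, v, w] := by
  have : IsManifold 𝓘(ℝ, E) 1 M := IsManifold.of_le (n := ∞) (by simp)
  have : IsManifold 𝓘(ℝ, E) 2 M := IsManifold.of_le (n := ∞) (by norm_cast)
  have hX := FiberBundle.mdifferentiableAt_extend 𝓘(ℝ, E) E v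
  have hY := FiberBundle.mdifferentiableAt_extend 𝓘(ℝ, E) E w
  have hZ := FiberBundle.mdifferentiableAt_extend 𝓘(ℝ, E) E u
  have h0 := (koszulConnection g c).torsion_apply hX hY
  have h1 := inner_koszulCov g c hX hY hZ
  have h2 := inner_koszulCov g c hY hX hZ
  -- Antisymmetrizing in the first two fields leaves twice the bracket term plus `2c`; subtracting
  -- the bracket gives the torsion.
  rw [koszul, VectorField.mlieBracket_swap_apply (V := FiberBundle.extend E w)] at h2
  rw [koszul] at h1
  simp only [FiberBundle.extend_apply_self] at h0 h1 h2
  rw [torsionTensor, h0, g.symm, koszulConnection_apply, form₃_rotate c u v w]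
  rw [innerDeriv_comm g (FiberBundle.extend E w) (FiberBundle.extend E v), form₃_swap₀₁ c w] at h2
  simp only [map_sub, sub_apply, map_neg, neg_apply] at h1 h2 ⊢
  rw [h1, h2]
  ring

theorem hasSkewTorsion_koszulConnection (g : Metric E M) (c : DiffForm E M ℝ 3) :
    HasSkewTorsion g (koszulConnection g c) := fun x u v w ↦ by
  simp only [torsionTensor_koszulConnection]
  exact ⟨form₃_swap₀₁ c u v w, form₃_swap₁₂ c u v w⟩

end KoszulConnection

/-! ### Smoothness of the Koszul connection. -/

section Smoothness

variable {E : Type*} [NormedAddCommGroup E] [NormedSpace ℝ E]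
  {M : Type*} [TopologicalSpace M] [ChartedSpace E M]

variable [IsManifold 𝓘(ℝ, E) ∞ M]

/-- A three-form is smooth if it takes smooth values on smooth vector fields. -/
def IsSmoothForm₃ (c : DiffForm E M ℝ 3) : Prop :=
  ∀ (x : M) (X Y Z : Π x : M, TangentSpace 𝓘(ℝ, E) x), CMDiffAt ∞ (T% X) x →
    CMDiffAt ∞ (T% Y) x → CMDiffAt ∞ (T% Z) x → CMDiffAt ∞ (fun y ↦ c y ![X y, Y y, Z y]) x

theorem eventually_mdifferentiableAt {X : Π x : M, TangentSpace 𝓘(ℝ, E) x} {x : M}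
    (hX : CMDiffAt ∞ (T% X) x) : ∀ᶠ y in 𝓝 x, MDiffAt (T% X) y := by
  have : IsManifold 𝓘(ℝ, E) 1 M := IsManifold.of_le (n := ∞) (by simp)
  have : IsManifold 𝓘(ℝ, E) (1 + 1) M := IsManifold.of_le (n := ∞) (by norm_cast)
  have h1 : CMDiffAt 1 (T% X) x := hX.of_le (by simp)
  filter_upwards [(contMDiffAt_iff_contMDiffAt_nhds (by simp)).1 h1] with y hy
  exact ContMDiffAt.mdifferentiableAt hy one_ne_zero

/-- The local vector field which is constant in the trivialization of the tangent bundle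
at `x`. -/
noncomputable def constField (x : M) (u : E) : Π y : M, TangentSpace 𝓘(ℝ, E) y :=
  fun y ↦ (trivializationAt E (TangentSpace 𝓘(ℝ, E)) x).symmL ℝ y u

theorem contMDiffAt_constField (x : M) (u : E) : CMDiffAt ∞ (T% (constField x u)) x := by
  have : IsManifold 𝓘(ℝ, E) 1 M := IsManifold.of_le (n := ∞) (by simp)
  rw [contMDiffAt_section]
  have : CMDiffAt ∞ (fun (_ : M) ↦ u) x := contMDiffAt_const
  refine this.congr_of_eventuallyEq ?_
  set t := trivializationAt E (TangentSpace 𝓘(ℝ, E)) x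
  filter_upwards [t.open_baseSet.mem_nhds (FiberBundle.mem_baseSet_trivializationAt' x)]
    with y hy
  exact congrArg Prod.snd ((congrArg (fun v ↦ t ⟨y, v⟩) (t.symmL_apply hy u)).trans
    (t.apply_mk_symm hy u))

variable [CompleteSpace E]

theorem contMDiffAt_mlieBracket {X Y : Π x : M, TangentSpace 𝓘(ℝ, E) x} {x : M}
    (hX : CMDiffAt ∞ (T% X) x) (hY : CMDiffAt ∞ (T% Y) x) :
    CMDiffAt ∞ (T% (VectorField.mlieBracket 𝓘(ℝ, E) X Y)) x := by
  have : IsManifold 𝓘(ℝ, E) (minSmoothness ℝ 2) M :=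
    IsManifold.of_le (n := ∞) (by rw [minSmoothness_of_isRCLikeNormedField]; norm_cast)
  have : IsManifold 𝓘(ℝ, E) (((⊤ : ℕ∞) : WithTop ℕ∞) + 1) M :=
    IsManifold.of_le (n := ∞) (by simp)
  exact ContMDiffAt.mlieBracket_vectorField (m := ⊤) (n := ⊤) hX hY
    (by rw [minSmoothness_of_isRCLikeNormedField]; simp)

theorem contMDiffAt_koszul (g : Metric E M) {c : DiffForm E M ℝ 3} (hc : IsSmoothForm₃ c)
    {X Y Z : Π x : M, TangentSpace 𝓘(ℝ, E) x} {x : M} (hX : CMDiffAt ∞ (T% X) x)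
    (hY : CMDiffAt ∞ (T% Y) x) (hZ : CMDiffAt ∞ (T% Z) x) :
    CMDiffAt ∞ (koszul g c X Y Z) x := by
  have hi {A B C : Π x : M, TangentSpace 𝓘(ℝ, E) x} (hA : CMDiffAt ∞ (T% A) x)
      (hB : CMDiffAt ∞ (T% B) x) (hC : CMDiffAt ∞ (T% C) x) :
      CMDiffAt ∞ (fun y ↦ innerDeriv g A B y (C y)) x :=
    contMDiffAt_mvfderiv_apply (contMDiffAt_inner g le_rfl hA hB) hC
  have hb {A B C : Π x : M, TangentSpace 𝓘(ℝ, E) x} (hA : CMDiffAt ∞ (T% A) x)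
      (hB : CMDiffAt ∞ (T% B) x) (hC : CMDiffAt ∞ (T% C) x) :
      CMDiffAt ∞ (fun y ↦ g.inner y (VectorField.mlieBracket 𝓘(ℝ, E) A B y) (C y)) x :=
    contMDiffAt_inner g le_rfl (contMDiffAt_mlieBracket hA hB) hC
  exact ((((((hi hY hZ hX).add (hi hX hZ hY)).sub (hi hX hY hZ)).add (hb hX hY hZ)).sub
    (hb hX hZ hY)).sub (hb hY hZ hX)).add (hc x X Y Z hX hY hZ)

theorem isSmoothForm₃_dc_kahlerForm [FiniteDimensional ℝ E] {g : Metric E M}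
    {S : ComplexStructure E M} (h : IsHermitian g S) : IsSmoothForm₃ (dc S.J (kahlerForm h)) := by
  intro x X Y Z hX hY hZ
  have hJX := S.contMDiffAt_apply hX
  have hJY := S.contMDiffAt_apply hY
  have hJZ := S.contMDiffAt_apply hZ
  have hi {A B C : Π x : M, TangentSpace 𝓘(ℝ, E) x} (hA : CMDiffAt ∞ (T% A) x)
      (hB : CMDiffAt ∞ (T% B) x) (hC : CMDiffAt ∞ (T% C) x) :
      CMDiffAt ∞ (fun y ↦ mvfderiv 𝓘(ℝ, E) (fun y ↦ g.inner y (S.J y (A y)) (B y)) y (C y)) x :=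
    contMDiffAt_mvfderiv_apply (contMDiffAt_inner g le_rfl (S.contMDiffAt_apply hA) hB) hC
  have hb {A B C : Π x : M, TangentSpace 𝓘(ℝ, E) x} (hA : CMDiffAt ∞ (T% A) x)
      (hB : CMDiffAt ∞ (T% B) x) (hC : CMDiffAt ∞ (T% C) x) : CMDiffAt ∞
        (fun y ↦ g.inner y (S.J y (VectorField.mlieBracket 𝓘(ℝ, E) A B y)) (C y)) x :=
    contMDiffAt_inner g le_rfl (S.contMDiffAt_apply (contMDiffAt_mlieBracket hA hB)) hC
  refine ((((((hi hJY hJZ hJX).sub (hi hJX hJZ hJY)).add (hi hJX hJY hJZ)).sub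
    (hb hJX hJY hJZ)).add (hb hJX hJZ hJY)).sub (hb hJY hJZ hJX)).neg.congr_of_eventuallyEq ?_
  -- Cartan's formula needs the fields differentiable at the point of evaluation, so smoothness at
  -- `x` has to be spread to a neighbourhood.
  filter_upwards [eventually_mdifferentiableAt hJX, eventually_mdifferentiableAt hJY,
    eventually_mdifferentiableAt hJZ] with y h1 h2 h3
  have e3 : (fun i ↦ S.J y ((![X y, Y y, Z y] : Fin 3 → TangentSpace 𝓘(ℝ, E) y) i))
        = ![S.J y (X y), S.J y (Y y), S.J y (Z y)] := by
    ext i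
    fin_cases i <;> rfl
  rw [dc_kahlerForm_apply, e3, h.d_kahlerForm_apply h1 h2 h3]
  rfl

theorem contMDiffAt_inner_koszulCov [FiniteDimensional ℝ E] (g : Metric E M)
    {c : DiffForm E M ℝ 3} (hc : IsSmoothForm₃ c) {X Y Z : Π x : M, TangentSpace 𝓘(ℝ, E) x} {x : M}
    (hX : CMDiffAt ∞ (T% X) x) (hY : CMDiffAt ∞ (T% Y) x) (hZ : CMDiffAt ∞ (T% Z) x) :
    CMDiffAt ∞ (fun y ↦ g.inner y (koszulCov g c Y y (X y)) (Z y)) x := by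
  have h0 : CMDiffAt ∞ (fun _ : M ↦ (1 / 2 : ℝ)) x := contMDiffAt_const
  refine (h0.mul (contMDiffAt_koszul g hc hX hY hZ)).congr_of_eventuallyEq ?_
  filter_upwards [eventually_mdifferentiableAt hX, eventually_mdifferentiableAt hY,
    eventually_mdifferentiableAt hZ] with y h1 h2 h3
  exact inner_koszulCov g c h1 h2 h3

theorem contMDiffAt_koszulCov [FiniteDimensional ℝ E] (g : Metric E M) {c : DiffForm E M ℝ 3}
    (hc : IsSmoothForm₃ c) {Y : Π x : M, TangentSpace 𝓘(ℝ, E) x} {x : M}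
    (hY : CMDiffAt ∞ (T% Y) x) :
    ContMDiffAt 𝓘(ℝ, E) (𝓘(ℝ, E).prod 𝓘(ℝ, E →L[ℝ] E)) ∞
      (fun y ↦ TotalSpace.mk' (E →L[ℝ] E)
        (E := fun x : M ↦ TangentSpace 𝓘(ℝ, E) x →L[ℝ] TangentSpace 𝓘(ℝ, E) x) y
        (koszulCov g c Y y)) x := by
  have : IsManifold 𝓘(ℝ, E) 1 M := IsManifold.of_le (n := ∞) (by simp)
  rw [contMDiffAt_hom_bundle]
  refine ⟨contMDiffAt_id, ?_⟩
  set t := trivializationAt E (TangentSpace 𝓘(ℝ, E)) x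
  let s : M → E →L[ℝ] E := fun y ↦ t.symmL ℝ y
  -- `G` is the Gram form of the local frame and `B(u, w) = g(∇_{su} Y, sw)`. In the frame, `∇Y` is
  -- `G⁻¹B`, so smoothness follows from that of `G`, `B` and operator inversion.
  let G : M → E →L[ℝ] E →L[ℝ] ℝ := fun y ↦
    ContinuousLinearMap.bilinearComp (E := E) (F := E) (g.inner y) (s y) (s y)
  let B : M → E →L[ℝ] E →L[ℝ] ℝ := fun y ↦
    ContinuousLinearMap.bilinearComp (E := E) (F := E) (g.inner y)
      (ContinuousLinearMap.comp (M₂ := E) (koszulCov g c Y y) (s y)) (s y)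
  have hG : ContMDiffAt 𝓘(ℝ, E) 𝓘(ℝ, E →L[ℝ] E →L[ℝ] ℝ) ∞ G x :=
    contMDiffAt_clm_of_apply fun u ↦ contMDiffAt_clm_of_apply fun w ↦
      contMDiffAt_inner g le_rfl (contMDiffAt_constField x u) (contMDiffAt_constField x w)
  have hB : ContMDiffAt 𝓘(ℝ, E) 𝓘(ℝ, E →L[ℝ] E →L[ℝ] ℝ) ∞ B x := by
    refine contMDiffAt_clm_of_apply fun u ↦ contMDiffAt_clm_of_apply fun w ↦ ?_
    exact contMDiffAt_inner_koszulCov g hc (contMDiffAt_constField x u) hY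
      (contMDiffAt_constField x w)
  have hpos : ∀ y ∈ t.baseSet, ∃ e : E ≃L[ℝ] (E →L[ℝ] ℝ), (e : E →L[ℝ] E →L[ℝ] ℝ) = G y := by
    intro y hy
    refine exists_equiv_of_pos _ fun v hv ↦ g.pos y _ fun h0 ↦ hv ?_
    have := t.continuousLinearMapAt_symmL (R := ℝ) hy v
    rw [← this]
    exact (congrArg (t.continuousLinearMapAt ℝ y) h0).trans (map_zero _)
  have hx : x ∈ t.baseSet := FiberBundle.mem_baseSet_trivializationAt' x
  obtain ⟨e, he⟩ := hpos x hx
  have hinv : ContMDiffAt 𝓘(ℝ, E) 𝓘(ℝ, (E →L[ℝ] ℝ) →L[ℝ] E) ∞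
      (fun y ↦ (G y).inverse) x := by
    have := contDiffAt_map_inverse (𝕜 := ℝ) (n := ∞) e
    rw [he] at this
    exact this.comp_contMDiffAt hG
  refine (hinv.clm_comp hB).congr_of_eventuallyEq ?_
  filter_upwards [t.open_baseSet.mem_nhds hx] with y hy
  obtain ⟨e', he'⟩ := hpos y hy
  rw [← he', ContinuousLinearMap.inverse_equiv]
  ext u
  refine e'.injective ?_
  rw [ContinuousLinearMap.comp_apply]
  refine Eq.trans ?_ (e'.apply_symm_apply (B y u)).symm
  ext w
  have h1 : e' = G y := he'
  have h2 : ∀ v, e' v w = g.inner y (s y v) (s y w) := fun v ↦ congr($h1 v w)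
  rw [h2]
  have h3 := t.symmL_continuousLinearMapAt (R := ℝ) hy (koszulCov g c Y y (s y u))
  exact congr(g.inner y $h3 (s y w))

theorem contMDiffCovariantDerivative_koszulConnection [FiniteDimensional ℝ E] (g : Metric E M)
    {c : DiffForm E M ℝ 3} (hc : IsSmoothForm₃ c) :
    CovariantDerivative.ContMDiffCovariantDerivative (koszulConnection g c) ∞ where
  contMDiff := ⟨fun {σ} hσ x _ ↦
    (contMDiffAt_koszulCov g hc ((hσ x (Set.mem_univ x)).contMDiffAt Filter.univ_mem
      |>.of_le (by simp))).contMDiffWithinAt⟩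

theorem isMetricSkewConnection_koszulConnection [FiniteDimensional ℝ E] (g : Metric E M)
    {c : DiffForm E M ℝ 3} (hc : IsSmoothForm₃ c) :
    IsMetricSkewConnection g (koszulConnection g c) where
  smooth := contMDiffCovariantDerivative_koszulConnection g hc
  metric := isMetric_koszulConnection g c
  skew := hasSkewTorsion_koszulConnection g c

end Smoothness

/-! ### Exterior derivative of complex combinations of real forms. -/

section ComplexForms

variable {E : Type*} [NormedAddCommGroup E] [NormedSpace ℝ E]
  {M : Type*} [TopologicalSpace M] [ChartedSpace E M]
  {V : Type*} [NormedAddCommGroup V] [NormedSpace ℝ V]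

theorem hasFDerivAt_compContinuousAlternatingMap {W : Type*} [NormedAddCommGroup W]
    [NormedSpace ℝ W] (L : V →L[ℝ] W) {n : ℕ} {η : E → E [⋀^Fin n]→L[ℝ] V} {y : E}
    (hη : DifferentiableAt ℝ η y) :
    HasFDerivAt (fun z ↦ L.compContinuousAlternatingMap (η z))
      ((ContinuousLinearMap.compContinuousAlternatingMapCLM ℝ E V W (Fin n) L).comp
        (fderiv ℝ η y)) y :=
  (ContinuousLinearMap.compContinuousAlternatingMapCLM ℝ E V W (Fin n) L).hasFDerivAt.comp y
    hη.hasFDerivAt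

theorem extDeriv_compContinuousAlternatingMap {W : Type*} [NormedAddCommGroup W]
    [NormedSpace ℝ W] (L : V →L[ℝ] W) {n : ℕ} {η : E → E [⋀^Fin n]→L[ℝ] V} {y : E}
    (hη : DifferentiableAt ℝ η y) (v : Fin (n + 1) → E) :
    extDeriv (fun z ↦ L.compContinuousAlternatingMap (η z)) y v = L (extDeriv η y v) := by
  rw [extDeriv, (hasFDerivAt_compContinuousAlternatingMap L hη).fderiv, extDeriv,
    ContinuousAlternatingMap.alternatizeUncurryFin_apply,
    ContinuousAlternatingMap.alternatizeUncurryFin_apply, map_sum]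
  refine Finset.sum_congr rfl fun i _ ↦ ?_
  rw [map_zsmul]
  rfl

theorem d_smul (r : ℝ) {n : ℕ} (α : DiffForm E M V n) (x : M)
    (v : Fin (n + 1) → TangentSpace 𝓘(ℝ, E) x) :
    d (fun y ↦ r • α y) x v = r • d α x v := by
  rw [d_apply, d_apply]
  exact congr($(extDeriv_fun_smul (x := extChartAt 𝓘(ℝ, E) x x) r (chartForm α x))
    (fun i ↦ chartDeriv x (v i)))

theorem d_toComplex_add_smul {n : ℕ} {α β : DiffForm E M ℝ n} {x : M} (z : ℂ)
    (hα : DifferentiableAt ℝ (chartForm α x) (extChartAt 𝓘(ℝ, E) x x))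
    (hβ : DifferentiableAt ℝ (chartForm β x) (extChartAt 𝓘(ℝ, E) x x))
    (v : Fin (n + 1) → TangentSpace 𝓘(ℝ, E) x) :
    d (fun y ↦ toComplex α y + z • toComplex β y) x v = d α x v + z * d β x v := by
  have h1 := hasFDerivAt_compContinuousAlternatingMap Complex.ofRealCLM hα
  have h2 := hasFDerivAt_compContinuousAlternatingMap (z • Complex.ofRealCLM) hβ
  have h3 := extDeriv_fun_add h1.differentiableAt h2.differentiableAt
  rw [d_apply, d_apply, d_apply]
  refine (congr($h3 (fun i ↦ chartDeriv x (v i)))).trans ?_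
  rw [ContinuousAlternatingMap.add_apply, extDeriv_compContinuousAlternatingMap _ hα,
    extDeriv_compContinuousAlternatingMap _ hβ]
  rfl

end ComplexForms

/-! ### Quaternionic algebra and the equivalence of the conditions. -/

section Quaternions

variable {E : Type*} [NormedAddCommGroup E] [NormedSpace ℝ E]
  {M : Type*} [TopologicalSpace M] [ChartedSpace E M] [IsManifold 𝓘(ℝ, E) ∞ M]

namespace HypercomplexStructure

variable (S : HypercomplexStructure E M) (x : M) (v : TangentSpace 𝓘(ℝ, E) x)

theorem mul₁₃ : S.I₁.J x (S.I₃.J x v) = -S.I₂.J x v := by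
  rw [← S.mul₁₂, S.I₁.sq]

theorem mul₃₁ : S.I₃.J x (S.I₁.J x v) = S.I₂.J x v := by
  rw [← S.mul₁₂, S.mul₂₁, map_neg, S.mul₁₃, neg_neg]

theorem mul₃₂ : S.I₃.J x (S.I₂.J x v) = -S.I₁.J x v := by
  rw [← S.mul₁₂, S.I₂.sq, map_neg]

end HypercomplexStructure

variable {g : Metric E M} {S : HypercomplexStructure E M}

namespace IsHyperHermitian

theorem kahlerForm₂_update (h : IsHyperHermitian g S) (x : M)
    (v : Fin 2 → TangentSpace 𝓘(ℝ, E) x) (i : Fin 2) :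
    kahlerForm h.I₂ x (Function.update v i (S.I₁.J x (v i))) = -kahlerForm h.I₃ x v := by
  rw [kahlerForm_apply, kahlerForm_apply]
  fin_cases i
  · change g.inner x (S.I₂.J x (S.I₁.J x (v 0))) (v 1) = _
    rw [S.mul₂₁, map_neg, neg_apply]
  · change g.inner x (S.I₂.J x (v 0)) (S.I₁.J x (v 1)) = _
    rw [← S.mul₁₂, h.I₁.inner_apply_left, neg_neg]

theorem kahlerForm₃_update (h : IsHyperHermitian g S) (x : M)
    (v : Fin 2 → TangentSpace 𝓘(ℝ, E) x) (i : Fin 2) :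
    kahlerForm h.I₃ x (Function.update v i (S.I₁.J x (v i))) = kahlerForm h.I₂ x v := by
  rw [kahlerForm_apply, kahlerForm_apply]
  fin_cases i
  · change g.inner x (S.I₃.J x (S.I₁.J x (v 0))) (v 1) = _
    rw [S.mul₃₁]
  · change g.inner x (S.I₃.J x (v 0)) (S.I₁.J x (v 1)) = _
    rw [← neg_neg (g.inner x _ _), ← h.I₁.inner_apply_left, S.mul₁₃, map_neg, neg_apply, neg_neg]

theorem isHolType_formPlus (h : IsHyperHermitian g S) : IsHolType S.I₁.J (formPlus h) := by
  intro x v i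
  have h0 (w) : formPlus h x w = kahlerForm h.I₂ x w + Complex.I * kahlerForm h.I₃ x w := rfl
  rw [h0, h0, h.kahlerForm₂_update, h.kahlerForm₃_update]
  push_cast
  linear_combination -(kahlerForm h.I₃ x v : ℂ) * Complex.I_mul_I

theorem isAntiholType_formMinus (h : IsHyperHermitian g S) :
    IsAntiholType S.I₁.J (formMinus h) := by
  intro x v i
  have h0 (w) : formMinus h x w = kahlerForm h.I₂ x w - Complex.I * kahlerForm h.I₃ x w := rfl
  rw [h0, h0, h.kahlerForm₂_update, h.kahlerForm₃_update]
  push_cast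
  linear_combination -(kahlerForm h.I₃ x v : ℂ) * Complex.I_mul_I

theorem kahlerForm₂_apply_I₁ (h : IsHyperHermitian g S) (x : M)
    (v : Fin 2 → TangentSpace 𝓘(ℝ, E) x) :
    kahlerForm h.I₂ x (fun i ↦ S.I₁.J x (v i)) = -kahlerForm h.I₂ x v := by
  rw [kahlerForm_apply, kahlerForm_apply, S.mul₂₁, ← S.mul₁₂, map_neg, neg_apply, h.I₁ x]

theorem kahlerForm₃_apply_I₁ (h : IsHyperHermitian g S) (x : M)
    (v : Fin 2 → TangentSpace 𝓘(ℝ, E) x) :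
    kahlerForm h.I₃ x (fun i ↦ S.I₁.J x (v i)) = -kahlerForm h.I₃ x v := by
  rw [kahlerForm_apply, kahlerForm_apply, S.mul₃₁, ← neg_neg (S.I₂.J x (v 0)), ← S.mul₁₃,
    map_neg, neg_apply, h.I₁ x]

/-- The form `F₂ + z F₃`. -/
noncomputable def pencil (h : IsHyperHermitian g S) (z : ℂ) : DiffForm E M ℂ 2 :=
  fun x ↦ toComplex (kahlerForm h.I₂) x + z • toComplex (kahlerForm h.I₃) x

theorem formPlus_eq_pencil (h : IsHyperHermitian g S) : formPlus h = h.pencil Complex.I := rfl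

theorem formMinus_eq_pencil (h : IsHyperHermitian g S) : formMinus h = h.pencil (-Complex.I) := by
  funext x
  rw [formMinus, pencil, neg_smul, sub_eq_add_neg]

/-- `I₁` is an isometry anticommuting with `I₂` and `I₃`, so applying it in both slots negates `F₂`
and `F₃`. Any `z` is allowed, so `z = i` and `z = -i` are covered together. -/
theorem act_pencil (h : IsHyperHermitian g S) (z : ℂ) :
    act S.I₁.J (h.pencil z) = fun x ↦ (-1 : ℝ) • h.pencil z x := by
  funext x
  ext v
  have h0 (w) : h.pencil z x w = kahlerForm h.I₂ x w + z * kahlerForm h.I₃ x w := rfl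
  rw [act_apply, ContinuousAlternatingMap.smul_apply, h0, h0, h.kahlerForm₂_apply_I₁, h.kahlerForm₃_apply_I₁]
  push_cast
  simp only [Complex.real_smul]
  push_cast
  ring

theorem dc_pencil_apply (h : IsHyperHermitian g S) (z : ℂ) (x : M)
    (v : Fin 3 → TangentSpace 𝓘(ℝ, E) x) :
    dc S.I₁.J (h.pencil z) x v = d (h.pencil z) x (fun i ↦ S.I₁.J x (v i)) := by
  have h1 : dc S.I₁.J (h.pencil z) x v =
      (-1 : ℝ) ^ 2 • act S.I₁.J (d (act S.I₁.J (h.pencil z))) x v :=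
    rfl
  rw [h1, act_pencil, act_apply, d_smul]
  norm_num

theorem form₃_apply_sq (J : ComplexStructure E M) (c : DiffForm E M ℝ 3) (x : M)
    (v : Fin 3 → TangentSpace 𝓘(ℝ, E) x) :
    c x (fun i ↦ J.J x (J.J x (v i))) = -c x v := by
  have e : (fun i ↦ J.J x (J.J x (v i))) = fun i ↦ (-1 : ℝ) • v i := by
    funext i
    rw [J.sq, neg_one_smul]
  rw [e, ContinuousAlternatingMap.map_smul_univ]
  norm_num

theorem dc_kahlerForm_eq_iff (h : IsHyperHermitian g S) :
    dc S.I₂.J (kahlerForm h.I₂) = dc S.I₃.J (kahlerForm h.I₃) ↔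
      ∀ (x : M) (v : Fin 3 → TangentSpace 𝓘(ℝ, E) x),
        d (kahlerForm h.I₂) x v = d (kahlerForm h.I₃) x (fun i ↦ S.I₁.J x (v i)) := by
  constructor
  · intro h1 x v
    -- Substituting `I₂v` gives `I₂² = -1` on one side and `I₃I₂ = -I₁` on the other; the signs
    -- match because the degree is odd.
    have h2 := congr($h1 x (fun i ↦ S.I₂.J x (v i)))
    rw [dc_kahlerForm_apply, dc_kahlerForm_apply, neg_inj,
      form₃_apply_sq S.I₂ (d (kahlerForm h.I₂))] at h2
    simp only [S.mul₃₂] at h2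
    have e : (fun i ↦ -S.I₁.J x (v i)) = fun i ↦ (-1 : ℝ) • S.I₁.J x (v i) := by simp
    rw [e, ContinuousAlternatingMap.map_smul_univ] at h2
    norm_num at h2
    exact h2
  · intro h1
    funext x
    ext v
    rw [dc_kahlerForm_apply, dc_kahlerForm_apply, h1]
    simp only [S.mul₁₂]

variable [FiniteDimensional ℝ E]

theorem d_pencil_apply (h : IsHyperHermitian g S) (z : ℂ) (x : M)
    (v : Fin 3 → TangentSpace 𝓘(ℝ, E) x) :
    d (h.pencil z) x v = d (kahlerForm h.I₂) x v + z * d (kahlerForm h.I₃) x v :=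
  d_toComplex_add_smul z (h.I₂.differentiableAt_chartForm x) (h.I₃.differentiableAt_chartForm x) v

theorem del_formPlus_eq_zero_iff (h : IsHyperHermitian g S) :
    del S.I₁.J (formPlus h) = 0 ↔ ∀ (x : M) (v : Fin 3 → TangentSpace 𝓘(ℝ, E) x),
      d (kahlerForm h.I₂) x v = d (kahlerForm h.I₃) x (fun i ↦ S.I₁.J x (v i)) := by
  rw [formPlus_eq_pencil]
  have h0 (x v) : del S.I₁.J (h.pencil Complex.I) x v = (1 / 2 : ℂ) *
      (((d (kahlerForm h.I₂) x v - d (kahlerForm h.I₃) x (fun i ↦ S.I₁.J x (v i)) : ℝ) : ℂ)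
        + (d (kahlerForm h.I₃) x v + d (kahlerForm h.I₂) x (fun i ↦ S.I₁.J x (v i)) : ℝ)
          * Complex.I) := by
    have h1 : del S.I₁.J (h.pencil Complex.I) x v = (1 / 2 : ℂ) *
      (d (h.pencil Complex.I) x v + Complex.I * dc S.I₁.J (h.pencil Complex.I) x v) := rfl
    rw [h1, dc_pencil_apply, d_pencil_apply, d_pencil_apply]
    push_cast
    linear_combination (1 / 2 : ℂ) * d (kahlerForm h.I₃) x (fun i ↦ S.I₁.J x (v i))
      * Complex.I_mul_I
  constructor
  · intro h2 x v
    have h3 := h0 x v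
    rw [h2] at h3
    -- The real part already is the claim; the imaginary part is the same equation evaluated at
    -- `I₁v`, which is how the converse recovers it.
    have h4 := congrArg Complex.re h3
    simp at h4
    linarith
  · intro h2
    funext x
    ext v
    have h3 := h2 x (fun i ↦ S.I₁.J x (v i))
    rw [form₃_apply_sq S.I₁ (d (kahlerForm h.I₃))] at h3
    rw [h0, h2 x v, h3]
    simp

theorem delbar_formMinus_eq_zero_iff (h : IsHyperHermitian g S) :
    delbar S.I₁.J (formMinus h) = 0 ↔ ∀ (x : M) (v : Fin 3 → TangentSpace 𝓘(ℝ, E) x),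
      d (kahlerForm h.I₂) x v = d (kahlerForm h.I₃) x (fun i ↦ S.I₁.J x (v i)) := by
  rw [formMinus_eq_pencil]
  have h0 (x v) : delbar S.I₁.J (h.pencil (-Complex.I)) x v = (1 / 2 : ℂ) *
      (((d (kahlerForm h.I₂) x v - d (kahlerForm h.I₃) x (fun i ↦ S.I₁.J x (v i)) : ℝ) : ℂ)
        - (d (kahlerForm h.I₃) x v + d (kahlerForm h.I₂) x (fun i ↦ S.I₁.J x (v i)) : ℝ)
          * Complex.I) := by
    have h1 : delbar S.I₁.J (h.pencil (-Complex.I)) x v = (1 / 2 : ℂ) *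
      (d (h.pencil (-Complex.I)) x v - Complex.I * dc S.I₁.J (h.pencil (-Complex.I)) x v) := rfl
    rw [h1, dc_pencil_apply, d_pencil_apply, d_pencil_apply]
    push_cast
    linear_combination (1 / 2 : ℂ) * d (kahlerForm h.I₃) x (fun i ↦ S.I₁.J x (v i))
      * Complex.I_mul_I
  constructor
  · intro h2 x v
    have h3 := h0 x v
    rw [h2] at h3
    have h4 := congrArg Complex.re h3
    simp at h4
    linarith
  · intro h2
    funext x
    ext v
    have h3 := h2 x (fun i ↦ S.I₁.J x (v i))
    rw [form₃_apply_sq S.I₁ (d (kahlerForm h.I₃))] at h3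
    rw [h0, h2 x v, h3]
    simp

variable [CompleteSpace E]

/-- A connection preserving `I₂` and `I₃` preserves `I₁ = -I₃I₂`. -/
theorem isHKT_iff : IsHKT g S ↔ SameBismutConnection g S.I₂ S.I₃ := by
  constructor
  · rintro ⟨cov, hc⟩
    exact ⟨cov, ⟨hc.toIsMetricSkewConnection, hc.parallel₂⟩,
      ⟨hc.toIsMetricSkewConnection, hc.parallel₃⟩⟩
  · rintro ⟨cov, h₂, h₃⟩
    refine ⟨cov, ⟨h₂.toIsMetricSkewConnection, ?_, h₂.parallel, h₃.parallel⟩⟩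
    intro Y x hY v
    have h2Y := S.I₂.mdifferentiableAt_apply hY
    have h3Y := S.I₃.mdifferentiableAt_apply h2Y
    have e : (fun y ↦ S.I₁.J y (Y y)) = fun y ↦ -S.I₃.J y (S.I₂.J y (Y y)) := by
      funext y
      rw [S.mul₃₂, neg_neg]
    rw [e, cov_neg cov h3Y, neg_apply, h₃.parallel _ x h2Y, h₂.parallel _ x hY, S.mul₃₂, neg_neg]

theorem sameBismutConnection_iff (h : IsHyperHermitian g S) :
    SameBismutConnection g S.I₂ S.I₃ ↔
      dc S.I₂.J (kahlerForm h.I₂) = dc S.I₃.J (kahlerForm h.I₃) := by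
  constructor
  · rintro ⟨cov, h₂, h₃⟩
    funext x
    ext v
    have e : v = ![v 0, v 1, v 2] := by
      ext i
      fin_cases i <;> rfl
    have e2 := (isParallel_iff h.I₂ h₂.metric h₂.skew).1 h₂.parallel x (v 0) (v 1) (v 2)
    have e3 := (isParallel_iff h.I₃ h₂.metric h₂.skew).1 h₃.parallel x (v 0) (v 1) (v 2)
    rw [← e] at e2 e3
    linarith
  · intro h1
    -- The Koszul connection with torsion `-d₂F₂ = -d₃F₃` meets the torsion criterion for both
    -- structures.
    have hs : IsSmoothForm₃ (fun x ↦ -dc S.I₂.J (kahlerForm h.I₂) x) :=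
      fun x X Y Z hX hY hZ ↦ (isSmoothForm₃_dc_kahlerForm h.I₂ x X Y Z hX hY hZ).neg
    have hc := isMetricSkewConnection_koszulConnection g hs
    refine ⟨_, ⟨hc, (isParallel_iff h.I₂ hc.metric hc.skew).2 fun x u v w ↦ ?_⟩,
      ⟨hc, (isParallel_iff h.I₃ hc.metric hc.skew).2 fun x u v w ↦ ?_⟩⟩
    · rw [torsionTensor_koszulConnection]
      rfl
    · rw [torsionTensor_koszulConnection, ← h1]
      rfl

end IsHyperHermitian

end Quaternions

end HKT

theorem mainTheorem1 {m : ℕ} {M : Type*} [TopologicalSpace M] [T2Space M]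
    [SecondCountableTopology M] [ChartedSpace (EuclideanSpace ℝ (Fin m)) M]
    [IsManifold (𝓡 m) ∞ M]
    (g : HKT.Metric (EuclideanSpace ℝ (Fin m)) M)
    (S : HKT.HypercomplexStructure (EuclideanSpace ℝ (Fin m)) M)
    (h : HKT.IsHyperHermitian g S) :
    HKT.IsHolType S.I₁.J (HKT.formPlus h) ∧
    HKT.IsAntiholType S.I₁.J (HKT.formMinus h) ∧
    List.TFAE
      [HKT.IsHKT g S,
        HKT.del S.I₁.J (HKT.formPlus h) = 0,
        HKT.delbar S.I₁.J (HKT.formMinus h) = 0,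
        HKT.dc S.I₂.J (HKT.kahlerForm h.I₂) = HKT.dc S.I₃.J (HKT.kahlerForm h.I₃),
        HKT.SameBismutConnection g S.I₂ S.I₃] := by
  refine ⟨h.isHolType_formPlus, h.isAntiholType_formMinus, ?_⟩
  tfae_have 1 ↔ 5 := HKT.IsHyperHermitian.isHKT_iff
  tfae_have 5 ↔ 4 := h.sameBismutConnection_iff
  tfae_have 2 ↔ 4 := h.del_formPlus_eq_zero_iff.trans h.dc_kahlerForm_eq_iff.symm
  tfae_have 3 ↔ 4 := h.delbar_formMinus_eq_zero_iff.trans h.dc_kahlerForm_eq_iff.symm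
  tfae_finish
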